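/- **Setting.** A *CC space* is a metric space $(\mathfrak X,d)$ with an operation assigning to all $n\ge 1$, $u_1,\dots,u_n\in\mathfrak X$ and $\lambda_1,\dots,\lambda_n>0$ with $\sum_i\lambda_i=1$ a point $[\lambda_i,u_i]_{i=1}^n=[\lambda_1,u_1;\dots;\lambda_n,u_n]\in\mathfrak X$ such that $[1,u]=u$ and: (i) $[\lambda_i,u_i]_{i=1}^n=[\lambda_{\sigma(i)},u_{\sigma(i)}]_{i=1}^n$ for every permutation $\sigma$; (ii) $[\lambda_i,u_i]_{i=1}^{n+2}=\big[\lambda_1,u_1;\dots;\lambda_n,u_n;\lambda_{n+1}+\lambda_{n+2},\big[\tfrac{\lambda_{n+j}}{\lambda_{n+1}+\lambda_{n+2}},u_{n+j}\big]_{j=1}^2\big]$; (iii) $\lambda\mapsto[\lambda,u;1-\lambda,v]$ is continuous on $(0,1)$ for all $u,v$; (iv) $d([\lambda,u_1;1-\lambda,u_2],[\lambda,v_1;1-\lambda,v_2])\le\lambda d(u_1,v_1)+(1-\lambda)d(u_2,v_2)$ for $\lambda\in(0,1)$; (v) for each $u$ the limit $Ku:=\lim_{n\to\infty}[n^{-1},u]_{i=1}^n$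 exists. Let $\mathfrak X$ be a nonempty, separable and complete CC space with its Borel $\sigma$-algebra, $(\Omega,\mathcal F,P)$ a probability space and $\mathcal G\subset\mathcal F$ a sub-$\sigma$-algebra. Functions are identified when they agree a.s., so measurability is understood up to a null set. $L^1_{\mathfrak X}(\mathcal G)$ is the set of $\mathcal G$-measurable $X:\Omega\to\mathfrak X$ such that $d(a,X)$ is integrable for some $a\in\mathfrak X$; $L^1_{K(\mathfrak X)}(\mathcal G)$ consists of those with values a.s. in $K(\mathfrak X)$, and $L^1_{\mathfrak X}=L^1_{\mathfrak X}(\mathcal F)$. Combinations with weights $\ge 0$ of sum $1$ are formed by dropping the terms of weight $0$. If $S$ takes only finitely many values $x_1,\dots,x_n$ (distinct), put $$ES=[P(S=x_i),Kx_i]_{i=1}^n,\qquad E(S|\mathcal G)=[E(I_{(S=x_i)}|\mathcal G),Kx_i]_{i=1}^n .$$ Fix any $u_0\in K(\mathfrak X)$ and any sequence $(u_j)_{j\ge1}$ dense in $\mathfrak X$, and let $\psi_n(x)=u_m$ with $m$ the smallest index in $\{0,\dots,n\}$ such that $d(u_m,x)=\min_{0\le j\le n}d(u_j,x)$. For $X\in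 L^1_{\mathfrak X}$ define $$EX=\lim_{n\to\infty}E\psi_n(X),\qquad E(X|\mathcal G)=\lim_{n\to\infty}E(\psi_n(X)|\mathcal G)\ \text{ a.s.}$$ **Proposition 4.10.** Let $X,Y\in L^1_{\mathfrak X}$. Then the limits defining $EX$ and (a.s.) $E(X|\mathcal G)$ exist, $E(X|\mathcal G)\in L^1_{K(\mathfrak X)}(\mathcal G)$, and the following hold (a.s. where they concern random elements): 1. $E(E(X|\mathcal G))=EX$. 2. If $\sigma(X)$ and $\mathcal G$ are independent, then $E(X|\mathcal G)=EX$. 3. If $X$ is $\mathcal G$-measurable, then $E(X|\mathcal G)=KX$. 4. If $\xi$ is a $\mathcal G$-measurable real random variable with $0<\xi<1$ a.s., then $[\xi,X;1-\xi,Y]\in L^1_{\mathfrak X}$ and $$E([\xi,X;1-\xi,Y]\,|\,\mathcal G)=[\xi,E(X|\mathcal G);1-\xi,E(Y|\mathcal G)].$$ In particular, $E([\lambda,X;1-\lambda,Y]\,|\,\mathcal G)=[\lambda,E(X|\mathcal G);1-\lambda,E(Y|\mathcal G)]$ for every $\lambda\in(0,1)$. 5. If $\mathcal G_1\subset\mathcal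 G_2\subset\mathcal F$ are $\sigma$-algebras, then $E(E(X|\mathcal G_1)|\mathcal G_2)=E(E(X|\mathcal G_2)|\mathcal G_1)=E(X|\mathcal G_1)$. -/

import Mathlib

open MeasureTheory ProbabilityTheory Filter Topology

/-- A list of weights `w 0, …, w (n-1)` that is admissible for a convex combination:
all weights are positive and they sum to `1` (so `n ≥ 1`). -/
def IsWeight {n : ℕ} (w : Fin n → ℝ) : Prop :=
  (∀ i, 0 < w i) ∧ ∑ i, w i = 1

/-- A convex combination space (CC space) in the sense of Terán and Molchanov.
`comb n w u` is the convex combination `[w 0, u 0; …; w (n-1), u (n-1)]`. It is only meaningful,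
and only constrained, for weights that are positive and sum to `1`; its values at all other
weights are arbitrary. (In particular a CC space is nonempty.) -/
class CCSpace (𝔛 : Type*) [MetricSpace 𝔛] where
  /-- the convex combination operation -/
  comb : (n : ℕ) → (Fin n → ℝ) → (Fin n → 𝔛) → 𝔛
  /-- `[1, u] = u` -/
  comb_one : ∀ u : 𝔛, comb 1 ![1] ![u] = u
  /-- commutativity -/
  comb_perm : ∀ (n : ℕ) (w : Fin n → ℝ) (u : Fin n → 𝔛) (σ : Equiv.Perm (Fin n)),
    IsWeight w → comb n (fun i => w (σ i)) (fun i => u (σ i)) = comb n w u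
  /-- associativity: the last two points may be combined first -/
  comb_assoc : ∀ (n : ℕ) (w : Fin (n + 2) → ℝ) (u : Fin (n + 2) → 𝔛), IsWeight w →
    let a : ℝ := w (Fin.last n).castSucc
    let b : ℝ := w (Fin.last (n + 1))
    comb (n + 2) w u =
      comb (n + 1)
        (Fin.snoc (α := fun _ => ℝ) (fun i : Fin n => w i.castSucc.castSucc) (a + b))
        (Fin.snoc (α := fun _ => 𝔛) (fun i : Fin n => u i.castSucc.castSucc)
          (comb 2 ![a / (a + b), b / (a + b)]
            ![u (Fin.last n).castSucc, u (Fin.last (n + 1))]))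
  /-- continuity in the weight -/
  comb_continuousOn : ∀ u v : 𝔛,
    ContinuousOn (fun t : ℝ => comb 2 ![t, 1 - t] ![u, v]) (Set.Ioo 0 1)
  /-- negative curvature -/
  dist_comb_le : ∀ (t : ℝ) (u₁ u₂ v₁ v₂ : 𝔛), 0 < t → t < 1 →
    dist (comb 2 ![t, 1 - t] ![u₁, u₂]) (comb 2 ![t, 1 - t] ![v₁, v₂]) ≤
      t * dist u₁ v₁ + (1 - t) * dist u₂ v₂
  /-- convexification: `[1/n, u; …; 1/n, u]` (`n` times) converges as `n → ∞` -/
  exists_tendsto_comb : ∀ u : 𝔛, ∃ v : 𝔛,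
    Tendsto (fun n : ℕ => comb n (fun _ => (n : ℝ)⁻¹) (fun _ => u)) atTop (𝓝 v)

namespace CCSpace

section Basic

variable {𝔛 : Type*} [MetricSpace 𝔛] [CCSpace 𝔛]

/-- The binary convex combination `[t, x; 1 - t, y]`. -/
def comb₂ (t : ℝ) (x y : 𝔛) : 𝔛 := comb 2 ![t, 1 - t] ![x, y]

/-- The convexification operator `K u = lim [1/n, u; …; 1/n, u]`. -/
noncomputable def K (u : 𝔛) : 𝔛 := Classical.choose (exists_tendsto_comb u)

/-- The combination `[w i, x i]_{i ∈ s}` for nonnegative weights of sum `1`: the terms of weight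
zero are dropped. (By commutativity the chosen enumeration of the remaining ones is
irrelevant.) -/
noncomputable def combOn {ι : Type*} (s : Finset ι) (w : ι → ℝ) (x : ι → 𝔛) : 𝔛 :=
  let J : Finset ι := s.filter (fun i => 0 < w i)
  comb J.card (fun k => w (J.equivFin.symm k)) (fun k => x (J.equivFin.symm k))

/-- Expectation `[P(S = x), K x]_x` of an `𝔛`-valued `S` with finitely many values `x`. -/
noncomputable def simpleExp {Ω : Type*} {mΩ : MeasurableSpace Ω} (P : Measure Ω)
    (S : Ω → 𝔛) (hS : (Set.range S).Finite) : 𝔛 :=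
  combOn hS.toFinset (fun x => P.real (S ⁻¹' {x})) K

/-- Conditional expectation `[E(1_{S = x} | 𝒢), K x]_x` of an `𝔛`-valued `S` with finitely many
values `x`. -/
noncomputable def simpleCondExp {Ω : Type*} (𝒢 : MeasurableSpace Ω) {mΩ : MeasurableSpace Ω}
    (P : Measure Ω) (S : Ω → 𝔛) (hS : (Set.range S).Finite) (ω : Ω) : 𝔛 :=
  combOn hS.toFinset (fun x => (P[(S ⁻¹' {x}).indicator (fun _ => (1 : ℝ)) | 𝒢]) ω) K

/-- `X ∈ L¹_𝔛(𝒢)`: `X` is `𝒢`-measurable (up to a null set, since the elements of `L¹` are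
taken up to a.s. equality) and `d(a, X)` is integrable for some point `a`. -/
def MemL1 {Ω : Type*} (𝒢 : MeasurableSpace Ω) {mΩ : MeasurableSpace Ω} (P : Measure Ω)
    (X : Ω → 𝔛) : Prop :=
  AEStronglyMeasurable[𝒢] X P ∧ ∃ a : 𝔛, Integrable (fun ω => dist a (X ω)) P

end Basic

section Approx

variable {𝔛 : Type*} [MetricSpace 𝔛] [MeasurableSpace 𝔛] [OpensMeasurableSpace 𝔛]

/-- The discretisation `ψₙ`: `ψₙ x = u m`, where `m` is the smallest index in `{0, …, n}` such
that `d(u m, x) = min_{0 ≤ j ≤ n} d(u j, x)`. -/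
noncomputable def psi (u : ℕ → 𝔛) (n : ℕ) (x : 𝔛) : 𝔛 := SimpleFunc.nearestPt u n x

theorem finite_range_psi_comp {Ω : Type*} (u : ℕ → 𝔛) (n : ℕ) (X : Ω → 𝔛) :
    (Set.range (fun ω => psi u n (X ω))).Finite :=
  (SimpleFunc.nearestPt u n).finite_range.subset (by
    rintro _ ⟨ω, rfl⟩
    exact ⟨X ω, rfl⟩)

variable [CCSpace 𝔛]

/-- `E ψₙ(X)`. -/
noncomputable def expSeq {Ω : Type*} {mΩ : MeasurableSpace Ω} (u : ℕ → 𝔛) (P : Measure Ω)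
    (X : Ω → 𝔛) (n : ℕ) : 𝔛 :=
  simpleExp P (fun ω => psi u n (X ω)) (finite_range_psi_comp u n X)

/-- `E(ψₙ(X) | 𝒢)`. -/
noncomputable def condExpSeq {Ω : Type*} (u : ℕ → 𝔛) (𝒢 : MeasurableSpace Ω)
    {mΩ : MeasurableSpace Ω} (P : Measure Ω) (X : Ω → 𝔛) (n : ℕ) (ω : Ω) : 𝔛 :=
  simpleCondExp 𝒢 P (fun ω => psi u n (X ω)) (finite_range_psi_comp u n X) ω

/-- The expectation `E X = lim E ψₙ(X)`. -/
noncomputable def expectation {Ω : Type*} {mΩ : MeasurableSpace Ω} (u : ℕ → 𝔛) (P : Measure Ω)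
    (X : Ω → 𝔛) : 𝔛 :=
  haveI : Nonempty 𝔛 := ⟨u 0⟩
  limUnder atTop (fun n => expSeq u P X n)

/-- The conditional expectation `E(X | 𝒢) = lim E(ψₙ(X) | 𝒢)` a.s. -/
noncomputable def condExpectation {Ω : Type*} (u : ℕ → 𝔛) (𝒢 : MeasurableSpace Ω)
    {mΩ : MeasurableSpace Ω} (P : Measure Ω) (X : Ω → 𝔛) (ω : Ω) : 𝔛 :=
  haveI : Nonempty 𝔛 := ⟨u 0⟩
  limUnder atTop (fun n => condExpSeq u 𝒢 P X n ω)

end Approx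

end CCSpace

/-! After convexification, a CC space is a convex subset of a Banach space. By
`exists_affine_embedding` there is a map `ι` into a Banach space that is affine for binary
combinations and satisfies `dist (ι x) (ι y) = dist (K x) (K y)`. It does not distinguish `x` from
`K x`, and it is isometric on the closed set of convex points, the range of `K`.

Applied to a finitely valued `S`, the definition of `E(S | 𝒢)` becomes the Bochner conditional
expectation of `ι ∘ S`. A conditional dominated convergence argument carries this over to the limit
of `ψₙ(X)`, and completeness pulls the limit back to a convex point (`condExpectation_spec`). Each
claim is then a known property of Bochner conditional expectations, transferred by injectivity of
`ι` on convex points (`eq_of_K`).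

The embedding is of Rådström type. Weighted points form a commutative monoid in which combinations
are sums. The quantity `s * dist (K x) (K y)` between points of equal mass `s` is invariant under
addition (`kdist_add_right`), because homotheties between convex points scale distances exactly
(`dist_comb₂_left`), whereas the axiom only gives an upper bound. Hence the distance of barycenters
defines a seminorm on signed finitely supported functions, and `ι` sends `x` to the point mass at
`x` in the completion. -/

namespace CCSpace

/-! ### The monoid of weighted points. -/

section Cone

variable {𝔛 : Type*} [MetricSpace 𝔛] [CCSpace 𝔛]

theorem comb_pair_eq {a b : ℝ} (h : a + b = 1) (x y : 𝔛) :
    comb 2 ![a, b] ![x, y] = comb₂ a x y := by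
  obtain rfl : b = 1 - a := by linarith
  rfl

theorem comb₂_comm {t : ℝ} (h₀ : 0 < t) (h₁ : t < 1) (x y : 𝔛) :
    comb₂ t x y = comb₂ (1 - t) y x := by
  have hw : IsWeight ![t, 1 - t] :=
    ⟨by intro i; fin_cases i <;> simp [h₀, h₁], by simp⟩
  have h := comb_perm 2 ![t, 1 - t] ![x, y] (Equiv.swap 0 1) hw
  rw [comb₂, ← h, ← comb_pair_eq (a := 1 - t) (b := t) (by ring)]
  congr 1 <;> ext i <;> fin_cases i <;> simp

theorem comb_triple_eq {p q r : ℝ} (hp : 0 < p) (hq : 0 < q) (hr : 0 < r) (h : p + q + r = 1)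
    (x y z : 𝔛) :
    comb 3 ![p, q, r] ![x, y, z] = comb₂ p x (comb₂ (q / (q + r)) y z) := by
  have hw : IsWeight ![p, q, r] :=
    ⟨by intro i; fin_cases i <;> simp [hp, hq, hr], by simp [Fin.sum_univ_three, h]⟩
  have h3 := comb_assoc 1 ![p, q, r] ![x, y, z] hw
  have e : comb 2 ![q / (q + r), r / (q + r)] ![y, z] = comb₂ (q / (q + r)) y z :=
    comb_pair_eq (by field_simp) y z
  rw [← comb_pair_eq (a := p) (b := q + r) (by linarith), ← e]
  refine h3.trans ?_
  congr 1 <;> ext i <;> fin_cases i <;> rfl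

/-- Both sides are the same ternary combination. The axiom merges only the last two points, so the
left side is obtained after a cyclic permutation. -/
theorem comb₂_assoc {p q r : ℝ} (hp : 0 < p) (hq : 0 < q) (hr : 0 < r) (h : p + q + r = 1)
    (x y z : 𝔛) :
    comb₂ (p + q) (comb₂ (p / (p + q)) x y) z = comb₂ p x (comb₂ (q / (q + r)) y z) := by
  have hw : IsWeight ![r, p, q] :=
    ⟨by intro i; fin_cases i <;> simp [hp, hq, hr], by simp [Fin.sum_univ_three]; linarith⟩
  have h1 := comb_perm 3 ![r, p, q] ![z, x, y] (finRotate 3) hw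
  rw [comb₂_comm (by linarith) (by linarith), show 1 - (p + q) = r by linarith,
    ← comb_triple_eq hr hp hq (by linarith), ← comb_triple_eq hp hq hr h, ← h1]
  congr 1 <;> ext i <;> fin_cases i <;> rfl

variable (𝔛) in
/-- The cone of weighted points over a CC space: pairs of a mass `s ≥ 0` and a point, where all
points of mass zero are identified. -/
@[ext]
structure WeightedPoint where
  /-- the mass -/
  mass : ℝ
  /-- the location -/
  pt : 𝔛
  mass_nonneg : 0 ≤ mass
  pt_eq : mass = 0 → pt = comb 0 ![] ![]

namespace WeightedPoint

/-- The meaningless combination of no points serves as a default location. Fixing it makes this the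
only element of mass zero, hence a strict unit for addition. -/
noncomputable instance : Zero (WeightedPoint 𝔛) := ⟨⟨0, comb 0 ![] ![], le_rfl, fun _ => rfl⟩⟩

open Classical in
/-- The mass `s` at `x`, read as zero if `s ≤ 0`. -/
noncomputable def wt (s : ℝ) (x : 𝔛) : WeightedPoint 𝔛 :=
  if h : 0 < s then ⟨s, x, h.le, fun h' => absurd h' h.ne'⟩ else 0

open Classical in
noncomputable instance : Add (WeightedPoint 𝔛) where
  add a b := if a.mass = 0 then b else if b.mass = 0 then a else
    wt (a.mass + b.mass) (comb₂ (a.mass / (a.mass + b.mass)) a.pt b.pt)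

@[simp] theorem mass_zero : (0 : WeightedPoint 𝔛).mass = 0 := rfl

@[simp] theorem wt_zero (x : 𝔛) : wt 0 x = 0 := by simp [wt]

theorem wt_mass {s : ℝ} (hs : 0 ≤ s) (x : 𝔛) : (wt s x).mass = s := by
  rcases hs.eq_or_lt with rfl | hs
  · simp
  · simp [wt, hs]

theorem wt_pt {s : ℝ} (hs : 0 < s) (x : 𝔛) : (wt s x).pt = x := by simp [wt, hs]

theorem wt_injective {s : ℝ} (hs : 0 < s) {x y : 𝔛} (h : wt s x = wt s y) : x = y := by
  rw [← wt_pt hs x, h, wt_pt hs]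

theorem mass_pos_of_ne_zero {a : WeightedPoint 𝔛} (ha : a ≠ 0) : 0 < a.mass := by
  refine lt_of_le_of_ne a.mass_nonneg fun h => ha ?_
  ext
  · exact h.symm
  · exact a.pt_eq h.symm

theorem eq_zero_or_wt (a : WeightedPoint 𝔛) : a = 0 ∨ ∃ s x, 0 < s ∧ a = wt s x := by
  by_cases ha : a = 0
  · exact .inl ha
  · have h := mass_pos_of_ne_zero ha
    refine .inr ⟨a.mass, a.pt, h, ?_⟩
    ext <;> simp [wt, h]

theorem wt_add_wt {s t : ℝ} (hs : 0 < s) (ht : 0 < t) (x y : 𝔛) :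
    wt s x + wt t y = wt (s + t) (comb₂ (s / (s + t)) x y) := by
  change (if _ then _ else _) = _
  rw [wt_mass hs.le, wt_mass ht.le, wt_pt hs, wt_pt ht, if_neg hs.ne', if_neg ht.ne']

protected theorem zero_add' (a : WeightedPoint 𝔛) : 0 + a = a := by
  change (if _ then _ else _) = _
  simp

protected theorem add_zero' (a : WeightedPoint 𝔛) : a + 0 = a := by
  change (if _ then _ else _) = _
  simp only [mass_zero, if_true]
  split_ifs with h
  · by_contra h'
    exact (mass_pos_of_ne_zero (Ne.symm h')).ne' h
  · rfl

protected theorem add_comm' (a b : WeightedPoint 𝔛) : a + b = b + a := by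
  rcases eq_zero_or_wt a with rfl | ⟨s, x, hs, rfl⟩
  · rw [WeightedPoint.zero_add', WeightedPoint.add_zero']
  rcases eq_zero_or_wt b with rfl | ⟨t, y, ht, rfl⟩
  · rw [WeightedPoint.zero_add', WeightedPoint.add_zero']
  rw [wt_add_wt hs ht, wt_add_wt ht hs, comb₂_comm (by positivity)
    (by rw [div_lt_one (by positivity)]; linarith), add_comm t s]
  congr 2
  field_simp
  ring

protected theorem add_assoc' (a b c : WeightedPoint 𝔛) : a + b + c = a + (b + c) := by
  rcases eq_zero_or_wt a with rfl | ⟨r, x, hr, rfl⟩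
  · simp only [WeightedPoint.zero_add']
  rcases eq_zero_or_wt b with rfl | ⟨s, y, hs, rfl⟩
  · simp only [WeightedPoint.zero_add', WeightedPoint.add_zero']
  rcases eq_zero_or_wt c with rfl | ⟨t, z, ht, rfl⟩
  · simp only [WeightedPoint.add_zero']
  rw [wt_add_wt hr hs, wt_add_wt (by positivity) ht, wt_add_wt hs ht,
    wt_add_wt hr (by positivity)]
  have h := comb₂_assoc (p := r / (r + s + t)) (q := s / (r + s + t)) (r := t / (r + s + t))
    (by positivity) (by positivity) (by positivity) (by field_simp) x y z
  have e1 : r / (r + s + t) + s / (r + s + t) = (r + s) / (r + s + t) := by field_simp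
  have e2 : r / (r + s + t) / ((r + s) / (r + s + t)) = r / (r + s) := by field_simp
  have e3 : s / (r + s + t) / (s / (r + s + t) + t / (r + s + t)) = s / (s + t) := by field_simp
  rw [e1, e2, e3] at h
  rw [h, add_assoc]

noncomputable instance : AddCommMonoid (WeightedPoint 𝔛) where
  add_assoc := WeightedPoint.add_assoc'
  zero_add := WeightedPoint.zero_add'
  add_zero := WeightedPoint.add_zero'
  add_comm := WeightedPoint.add_comm'
  nsmul := nsmulRec

theorem mass_add (a b : WeightedPoint 𝔛) : (a + b).mass = a.mass + b.mass := by
  rcases eq_zero_or_wt a with rfl | ⟨r, x, hr, rfl⟩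
  · simp
  rcases eq_zero_or_wt b with rfl | ⟨s, y, hs, rfl⟩
  · simp
  rw [wt_add_wt hr hs, wt_mass (by positivity), wt_mass hr.le, wt_mass hs.le]

variable (𝔛) in
/-- The mass as an additive homomorphism. -/
noncomputable def massHom : WeightedPoint 𝔛 →+ ℝ where
  toFun := mass
  map_zero' := rfl
  map_add' := mass_add

/-- An additive homomorphism out of the cone is given by a function that is compatible with binary
combinations. -/
noncomputable def lift {M : Type*} [AddCommMonoid M] (f : ℝ → 𝔛 → M) (h₀ : ∀ x, f 0 x = 0)
    (h : ∀ s t x y, 0 < s → 0 < t → f (s + t) (comb₂ (s / (s + t)) x y) = f s x + f t y) :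
    WeightedPoint 𝔛 →+ M where
  toFun a := f a.mass a.pt
  map_zero' := h₀ _
  map_add' a b := by
    rcases eq_zero_or_wt a with rfl | ⟨r, x, hr, rfl⟩
    · simp [h₀]
    rcases eq_zero_or_wt b with rfl | ⟨s, y, hs, rfl⟩
    · simp [h₀]
    have hrs : 0 < r + s := by positivity
    rw [wt_add_wt hr hs, wt_mass hrs.le, wt_pt hrs, wt_mass hr.le, wt_mass hs.le, wt_pt hr,
      wt_pt hs, h r s x y hr hs]

theorem lift_wt {M : Type*} [AddCommMonoid M] (f : ℝ → 𝔛 → M) (h₀ : ∀ x, f 0 x = 0)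
    (h : ∀ s t x y, 0 < s → 0 < t → f (s + t) (comb₂ (s / (s + t)) x y) = f s x + f t y)
    {s : ℝ} (hs : 0 ≤ s) (x : 𝔛) : lift f h₀ h (wt s x) = f s x := by
  change f _ _ = _
  rcases hs.eq_or_lt with rfl | hs
  · simp [h₀]
  · rw [wt_mass hs.le, wt_pt hs]

/-- Multiplication of the masses by `c > 0`. -/
noncomputable def scale (c : ℝ) (hc : 0 < c) : WeightedPoint 𝔛 →+ WeightedPoint 𝔛 :=
  lift (fun s x => wt (c * s) x) (by simp) fun s t x y hs ht => by
    rw [wt_add_wt (by positivity) (by positivity), ← mul_add, mul_div_mul_left _ _ hc.ne']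

theorem scale_wt {c : ℝ} (hc : 0 < c) {s : ℝ} (hs : 0 ≤ s) (x : 𝔛) :
    scale c hc (wt s x) = wt (c * s) x := lift_wt _ _ _ hs x

theorem wt_comb₂ {s t : ℝ} (hs : 0 < s) (h₀ : 0 < t) (h₁ : t < 1) (x y : 𝔛) :
    wt s (comb₂ t x y) = wt (s * t) x + wt (s * (1 - t)) y := by
  have : 0 < 1 - t := by linarith
  rw [wt_add_wt (by positivity) (by positivity)]
  congr 2 <;> field_simp <;> ring

/-- Iterated associativity turns every combination into a finite sum in the monoid. Together with
`wt_injective`, this reduces identities between combinations to arithmetic of masses. -/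
theorem wt_comb {n : ℕ} (w : Fin n → ℝ) (u : Fin n → 𝔛) (hw : IsWeight w) :
    wt 1 (comb n w u) = ∑ i, wt (w i) (u i) := by
  induction n with
  | zero => simp [IsWeight] at hw
  | succ n ih =>
    cases n with
    | zero =>
      have h1 : w 0 = 1 := by simpa using hw.2
      have : w = ![1] := by ext i; fin_cases i; simpa using h1
      have hu : u = ![u 0] := by ext i; fin_cases i; rfl
      rw [this, hu, comb_one]
      simp
    | succ n =>
      have hs := hw.2
      rw [Fin.sum_univ_castSucc, Fin.sum_univ_castSucc] at hs
      have ha := hw.1 (Fin.last n).castSucc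
      have hb := hw.1 (Fin.last (n + 1))
      rw [comb_assoc n w u hw]
      have hw' : IsWeight (Fin.snoc (α := fun _ => ℝ) (fun i : Fin n => w i.castSucc.castSucc)
          (w (Fin.last n).castSucc + w (Fin.last (n + 1)))) := by
        refine ⟨fun i => ?_, ?_⟩
        · induction i using Fin.lastCases with
          | last => simpa using add_pos ha hb
          | cast i => simpa using hw.1 _
        · rw [Fin.sum_univ_castSucc]
          simp only [Fin.snoc_castSucc, Fin.snoc_last]
          linarith
      rw [ih _ _ hw', Fin.sum_univ_castSucc, Fin.sum_univ_castSucc, Fin.sum_univ_castSucc]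
      simp only [Fin.snoc_castSucc, Fin.snoc_last]
      rw [comb_pair_eq (by field_simp), add_assoc, wt_add_wt ha hb]

end WeightedPoint

/-! ### The convexification operator. -/

open WeightedPoint

theorem continuous_comb₂ {t : ℝ} (h₀ : 0 < t) (h₁ : t < 1) :
    Continuous fun p : 𝔛 × 𝔛 => comb₂ t p.1 p.2 := by
  refine (LipschitzWith.of_dist_le_mul (K := 1) fun p q => ?_).continuous
  have h := dist_comb_le t p.1 p.2 q.1 q.2 h₀ h₁
  have a : dist p.1 q.1 ≤ dist p q := le_max_left _ _
  have b : dist p.2 q.2 ≤ dist p q := le_max_right _ _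
  refine h.trans ?_
  simp only [NNReal.coe_one, one_mul]
  nlinarith

/-- The average of `n` copies of `u`. -/
noncomputable def avg (n : ℕ) (u : 𝔛) : 𝔛 := comb n (fun _ => (n : ℝ)⁻¹) (fun _ => u)

theorem tendsto_avg (u : 𝔛) : Tendsto (fun n => avg n u) atTop (𝓝 (K u)) :=
  Classical.choose_spec (exists_tendsto_comb u)

theorem wt_avg {n : ℕ} (hn : 0 < n) {s : ℝ} (hs : 0 < s) (u : 𝔛) :
    wt s (avg n u) = n • wt (s / n) u := by
  have hn' : (0 : ℝ) < n := by exact_mod_cast hn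
  have h := wt_comb (fun _ : Fin n => (n : ℝ)⁻¹) (fun _ => u)
    ⟨fun _ => by positivity, by simp [hn'.ne']⟩
  have h2 := congrArg (scale s hs) h
  rw [scale_wt hs zero_le_one, map_sum, mul_one] at h2
  rw [avg, h2, Finset.sum_congr rfl fun i _ => scale_wt hs (inv_nonneg.2 hn'.le) u]
  simp [div_eq_mul_inv]

theorem avg_add {p q : ℕ} (hp : 0 < p) (hq : 0 < q) (u : 𝔛) :
    avg (p + q) u = comb₂ (p / (p + q) : ℝ) (avg p u) (avg q u) := by
  have hp' : (0 : ℝ) < p := by exact_mod_cast hp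
  have hq' : (0 : ℝ) < q := by exact_mod_cast hq
  apply wt_injective one_pos
  have h1 : (p / (p + q) : ℝ) < 1 := by rw [div_lt_one (by positivity)]; linarith
  have h2 : (0 : ℝ) < 1 - p / (p + q) := by linarith
  rw [wt_avg (by omega) one_pos, wt_comb₂ one_pos (by positivity) h1,
    wt_avg hp (by positivity), wt_avg hq (by linarith), add_nsmul]
  congr 3 <;> · push_cast; field_simp; try ring

theorem avg_one (u : 𝔛) : avg 1 u = u := by
  apply wt_injective one_pos
  rw [wt_avg one_pos one_pos]
  simp

theorem dist_avg_le {n : ℕ} (hn : 0 < n) (u v : 𝔛) : dist (avg n u) (avg n v) ≤ dist u v := by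
  induction n, hn using Nat.le_induction with
  | base => simp [avg_one]
  | succ n hn ih =>
    have hn' : (0 : ℝ) < n := by exact_mod_cast hn
    rw [avg_add hn one_pos, avg_add hn one_pos, avg_one, avg_one, Nat.cast_one]
    have h1 : (n / (n + 1) : ℝ) < 1 := by rw [div_lt_one (by positivity)]; linarith
    have := dist_comb_le (n / (n + 1) : ℝ) (avg n u) u (avg n v) v (by positivity) h1
    have h0 : (0 : ℝ) ≤ n / (n + 1) := by positivity
    refine this.trans ?_
    nlinarith

theorem avg_comb₂ {n : ℕ} (hn : 0 < n) {t : ℝ} (h₀ : 0 < t) (h₁ : t < 1) (x y : 𝔛) :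
    avg n (comb₂ t x y) = comb₂ t (avg n x) (avg n y) := by
  have hn' : (0 : ℝ) < n := by exact_mod_cast hn
  apply wt_injective one_pos
  rw [wt_avg hn one_pos, wt_comb₂ (by positivity) h₀ h₁, wt_comb₂ one_pos h₀ h₁, nsmul_add,
    wt_avg hn (by positivity), wt_avg hn (by linarith)]
  congr 3 <;> ring

theorem dist_K_le (u v : 𝔛) : dist (K u) (K v) ≤ dist u v :=
  le_of_tendsto ((tendsto_avg u).dist (tendsto_avg v))
    ((eventually_gt_atTop 0).mono fun _ hn => dist_avg_le hn u v)

theorem continuous_K : Continuous (K : 𝔛 → 𝔛) :=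
  (LipschitzWith.of_dist_le_mul (K := 1) fun u v => by simpa using dist_K_le u v).continuous

theorem K_comb₂ {t : ℝ} (h₀ : 0 < t) (h₁ : t < 1) (x y : 𝔛) :
    K (comb₂ t x y) = comb₂ t (K x) (K y) := by
  refine tendsto_nhds_unique (tendsto_avg _) ?_
  have h := ((continuous_comb₂ h₀ h₁).tendsto (K x, K y)).comp
    ((tendsto_avg x).prodMk_nhds (tendsto_avg y))
  refine h.congr' ((eventually_gt_atTop 0).mono fun n hn => ?_)
  exact (avg_comb₂ hn h₀ h₁ x y).symm

/-- The average of `(p + q) * k` copies of `u` splits into averages of `p * k` and `q * k` copies.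
All three converge to `K u` as `k → ∞`. -/
theorem comb₂_K_self_nat {p q : ℕ} (hp : 0 < p) (hq : 0 < q) (u : 𝔛) :
    comb₂ (p / (p + q) : ℝ) (K u) (K u) = K u := by
  have hp' : (0 : ℝ) < p := by exact_mod_cast hp
  have hq' : (0 : ℝ) < q := by exact_mod_cast hq
  have h1 : (p / (p + q) : ℝ) < 1 := by rw [div_lt_one (by positivity)]; linarith
  have hk : ∀ r : ℕ, 0 < r → Tendsto (fun k : ℕ => r * k) atTop atTop := fun r hr =>
    tendsto_id.const_mul_atTop' hr
  have h := ((continuous_comb₂ (by positivity) h1).tendsto (K u, K u)).comp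
    (((tendsto_avg u).comp (hk p hp)).prodMk_nhds ((tendsto_avg u).comp (hk q hq)))
  refine tendsto_nhds_unique h ?_
  refine ((tendsto_avg u).comp (hk (p + q) (by omega))).congr'
    ((eventually_gt_atTop 0).mono fun k hk => ?_)
  have hk' : (0 : ℝ) < k := by exact_mod_cast hk
  simp only [Function.comp_apply]
  rw [add_mul, avg_add (by positivity) (by positivity)]
  congr 1
  push_cast
  field_simp

/-- The rational case extends by continuity in the weight: an inequality at `t` would persist at a
nearby rational. -/
theorem comb₂_K_self {t : ℝ} (h₀ : 0 < t) (h₁ : t < 1) (u : 𝔛) :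
    comb₂ t (K u) (K u) = K u := by
  by_contra hne
  have hc : ContinuousAt (fun t : ℝ => comb₂ t (K u) (K u)) t :=
    (comb_continuousOn (K u) (K u)).continuousAt (Ioo_mem_nhds h₀ h₁)
  have hev := (hc.eventually_ne hne).and (Ioo_mem_nhds h₀ h₁)
  obtain ⟨V, hV, hVo, htV⟩ := eventually_nhds_iff.1 hev
  obtain ⟨r, hr⟩ := Rat.denseRange_cast.exists_mem_open hVo ⟨t, htV⟩
  obtain ⟨hr1, hr0, hr2⟩ := hV _ hr
  have hr0' : 0 < r := by exact_mod_cast hr0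
  have hr2' : r < 1 := by exact_mod_cast hr2
  have hnum : 0 < r.num := Rat.num_pos.2 hr0'
  have hlt : r.num < r.den := Rat.num_lt_denom_iff.2 hr2'
  apply hr1
  -- Writing the rational weight as `num / den`, the two multiplicities are `num` and `den - num`.
  have h := comb₂_K_self_nat (p := r.num.toNat) (q := r.den - r.num.toNat) (by omega) (by omega) u
  convert h using 2
  rw [Nat.cast_sub (by omega), add_sub_cancel]
  have : ((r.num.toNat : ℕ) : ℝ) = ((r.num : ℤ) : ℝ) := by
    rw [← Int.cast_natCast, Int.toNat_of_nonneg hnum.le]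
  rw [this, Rat.cast_def]

/-- Masses at a convex point may be split and merged freely. This makes the barycenter additive in
the masses. -/
theorem wt_add_K {s t : ℝ} (hs : 0 ≤ s) (ht : 0 ≤ t) (u : 𝔛) :
    wt (s + t) (K u) = wt s (K u) + wt t (K u) := by
  rcases hs.eq_or_lt with rfl | hs
  · simp
  rcases ht.eq_or_lt with rfl | ht
  · simp
  rw [wt_add_wt hs ht, comb₂_K_self (by positivity)]
  rw [div_lt_one (by positivity)]
  linarith

theorem avg_K {n : ℕ} (hn : 0 < n) (u : 𝔛) : avg n (K u) = K u := by
  induction n, hn using Nat.le_induction with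
  | base => simp [avg_one]
  | succ n hn ih =>
    have hn' : (0 : ℝ) < n := by exact_mod_cast hn
    rw [avg_add hn one_pos, avg_one, ih]
    exact_mod_cast comb₂_K_self_nat (p := n) (q := 1) hn one_pos u

theorem K_K (u : 𝔛) : K (K u) = K u :=
  tendsto_nhds_unique (tendsto_avg _) (tendsto_const_nhds.congr'
    ((eventually_gt_atTop 0).mono fun _ hn => (avg_K hn u).symm))

theorem mem_range_K_iff {x : 𝔛} : x ∈ Set.range (K : 𝔛 → 𝔛) ↔ K x = x :=
  ⟨by rintro ⟨y, rfl⟩; exact K_K y, fun h => ⟨x, h⟩⟩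

theorem isClosed_range_K : IsClosed (Set.range (K : 𝔛 → 𝔛)) := by
  have : Set.range (K : 𝔛 → 𝔛) = {x | K x = x} := Set.ext fun _ => mem_range_K_iff
  rw [this]
  exact isClosed_eq continuous_K continuous_id

/-- The convexification operator as an additive map of the cone. -/
noncomputable def KHom : WeightedPoint 𝔛 →+ WeightedPoint 𝔛 :=
  lift (fun s x => wt s (K x)) (by simp) fun s t x y hs ht => by
    rw [wt_add_wt hs ht, K_comb₂ (by positivity)]
    rw [div_lt_one (by positivity)]
    linarith

theorem KHom_wt {s : ℝ} (hs : 0 ≤ s) (x : 𝔛) : KHom (wt s x) = wt s (K x) := lift_wt _ _ _ hs x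

theorem K_comb_K {n : ℕ} (w : Fin n → ℝ) (u : Fin n → 𝔛) (hw : IsWeight w) :
    K (comb n w fun i => K (u i)) = comb n w fun i => K (u i) := by
  apply wt_injective one_pos
  rw [← KHom_wt zero_le_one, wt_comb _ _ hw, map_sum]
  refine Finset.sum_congr rfl fun i _ => ?_
  rw [KHom_wt (hw.1 i).le, K_K]

end Cone

/-! ### Finitely supported signed masses. -/

section FinsuppReal

open scoped NNReal

variable {𝔛 : Type*}

/-- Finitely supported nonnegative functions as elements of a real vector space. -/
noncomputable def toRealFinsupp : (𝔛 →₀ ℝ≥0) →+ (𝔛 →₀ ℝ) :=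
  Finsupp.mapRange.addMonoidHom NNReal.toRealHom.toAddMonoidHom

theorem toRealFinsupp_apply (m : 𝔛 →₀ ℝ≥0) (x : 𝔛) : toRealFinsupp m x = (m x : ℝ) := rfl

theorem toRealFinsupp_injective : Function.Injective (toRealFinsupp (𝔛 := 𝔛)) := fun m n h => by
  ext x
  exact DFunLike.congr_fun h x

/-- The positive part of a finitely supported function. -/
noncomputable def posFinsupp (m : 𝔛 →₀ ℝ) : 𝔛 →₀ ℝ≥0 := m.mapRange Real.toNNReal (by simp)

theorem toReal_pos_sub (m : 𝔛 →₀ ℝ) :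
    toRealFinsupp (posFinsupp m) - toRealFinsupp (posFinsupp (-m)) = m := by
  ext x
  simp [toRealFinsupp_apply, posFinsupp]

variable (𝔛) in
/-- The total mass of a finitely supported function. -/
noncomputable def total : (𝔛 →₀ ℝ) →ₗ[ℝ] ℝ := Finsupp.lsum ℝ fun _ => LinearMap.id

theorem total_single (x : 𝔛) (r : ℝ) : total 𝔛 (Finsupp.single x r) = r := by simp [total]

theorem toReal_single (x : 𝔛) (r : ℝ≥0) :
    toRealFinsupp (Finsupp.single x r) = Finsupp.single x (r : ℝ) := by
  simp [toRealFinsupp]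

end FinsuppReal

/-! ### Exact scaling of homotheties and the invariant distance. -/

section Embedding

variable {𝔛 : Type*} [MetricSpace 𝔛] [CCSpace 𝔛]

open WeightedPoint

theorem dist_comb₂_le {t : ℝ} (h₀ : 0 < t) (h₁ : t < 1) (x y x' y' : 𝔛) :
    dist (comb₂ t x y) (comb₂ t x' y') ≤ t * dist x x' + (1 - t) * dist y y' :=
  dist_comb_le t x y x' y' h₀ h₁

theorem dist_comb₂_self_le {t : ℝ} (h₀ : 0 < t) (h₁ : t < 1) (x z : 𝔛) (hx : K x = x) :
    dist x (comb₂ t x z) ≤ (1 - t) * dist x z := by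
  have h := dist_comb₂_le h₀ h₁ x x x z
  have hxx : comb₂ t x x = x := by simpa [hx] using comb₂_K_self h₀ h₁ x
  simpa [hxx] using h

/-- Towards a point of the segment from `x` to `y`, homotheties shrink the segments parallel to
that from `x` to `y` at most in proportion to their lengths. -/
theorem mul_dist_comb₂_le {t r : ℝ} (h₀ : 0 < t) (htr : t < r) (hr : r < 1) {x y z : 𝔛}
    (hx : K x = x) (hy : K y = y) (hz : K z = z) :
    t * dist (comb₂ r x z) (comb₂ r y z) ≤ r * dist (comb₂ t x z) (comb₂ t y z) := by
  set a := comb₂ t x z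
  set b := comb₂ t y z
  set a' := comb₂ r x z
  set b' := comb₂ r y z
  set q := comb₂ (1 / 2) x y
  -- Contracting `a` towards the midpoint `q` of `x` and `y` by `θ` leaves mass `θ * (1 - t) = 1 -
  -- r` at `z`. The image therefore lies on the segment from `a'` to `b'`; matching the mass at `y`
  -- gives its weight `β` at `b'`.
  set θ : ℝ := (1 - r) / (1 - t) with hθ
  have ht1 : 0 < 1 - t := by linarith
  have hr0 : 0 < r := h₀.trans htr
  have hr1 : 0 < 1 - r := by linarith
  have hθ0 : 0 < θ := by positivity
  have hθ1 : θ < 1 := by rw [hθ, div_lt_one ht1]; linarith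
  have hθt : θ * (1 - t) = 1 - r := by rw [hθ]; field_simp
  set β : ℝ := (1 - θ) / 2 / r with hβ
  have hθ2 : 0 < 1 - θ := by linarith
  have hβ0 : 0 < β := by positivity
  have hβr : β * r = (1 - θ) / 2 := by rw [hβ]; field_simp
  have hβ2 : r * (1 - 2 * β) = θ * t := by linarith
  have hβ1 : β < 1 / 2 := by
    have : 0 < r * (1 - 2 * β) := by rw [hβ2]; positivity
    have := pos_of_mul_pos_right this hr0.le
    linarith
  have hadd : ∀ {x : 𝔛}, K x = x → ∀ {s t : ℝ}, 0 ≤ s → 0 ≤ t →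
      wt (s + t) x = wt s x + wt t x := fun {x} hx {s t} hs ht => by
    have := wt_add_K hs ht x
    rwa [hx] at this
  have key : ∀ {x y : 𝔛}, K x = x → comb₂ (1 - θ) (comb₂ (1 / 2) x y) (comb₂ t x z) =
      comb₂ (1 - β) (comb₂ r x z) (comb₂ r y z) := fun {x y} hx => by
    apply wt_injective one_pos
    rw [wt_comb₂ one_pos (by linarith) (by linarith), wt_comb₂ one_pos (by linarith) (by linarith),
      wt_comb₂ (by linarith) (by linarith) (by linarith),
      wt_comb₂ (by linarith) (by linarith) (by linarith),
      wt_comb₂ (by linarith) (by linarith) (by linarith),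
      wt_comb₂ (by linarith) (by linarith) (by linarith)]
    have e1 : 1 * (1 - β) * r = 1 * (1 - θ) * (1 / 2) + 1 * (1 - (1 - θ)) * t := by linarith
    have e2 : 1 * (1 - θ) * (1 - 1 / 2) = 1 * (1 - (1 - β)) * r := by linarith
    have e3 : 1 * (1 - (1 - θ)) * (1 - t) = 1 * (1 - β) * (1 - r) + 1 * (1 - (1 - β)) * (1 - r) := by
      linarith
    have p1 : 0 ≤ 1 * (1 - θ) * (1 / 2) := by linarith
    have p2 : 0 ≤ 1 * (1 - (1 - θ)) * t := by rw [one_mul, sub_sub_cancel]; positivity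
    have p3 : 0 ≤ 1 * (1 - β) * (1 - r) := by
      have : 0 < 1 - β := by linarith
      positivity
    have p4 : 0 ≤ 1 * (1 - (1 - β)) * (1 - r) := by rw [one_mul, sub_sub_cancel]; positivity
    rw [e1, e2, e3, hadd hx p1 p2, hadd hz p3 p4]
    abel
  have ka : comb₂ (1 - θ) q a = comb₂ (1 - β) a' b' := key hx
  have kb : comb₂ (1 - θ) q b = comb₂ (1 - β) b' a' := by
    have hq : q = comb₂ (1 / 2) y x := by
      have := comb₂_comm (t := 1 / 2) (by norm_num) (by norm_num) x y
      rwa [show (1 - 1 / 2 : ℝ) = 1 / 2 by norm_num] at this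
    rw [hq]
    exact key hy
  have hKa' : K a' = a' := by rw [K_comb₂ hr0 hr, hx, hz]
  have hKb' : K b' = b' := by rw [K_comb₂ hr0 hr, hy, hz]
  have d1 : dist a' (comb₂ (1 - β) a' b') ≤ β * dist a' b' := by
    simpa using dist_comb₂_self_le (t := 1 - β) (by linarith) (by linarith) a' b' hKa'
  have d2 : dist b' (comb₂ (1 - β) b' a') ≤ β * dist a' b' := by
    rw [dist_comm a']
    simpa using dist_comb₂_self_le (t := 1 - β) (by linarith) (by linarith) b' a' hKb'
  have d3 : dist (comb₂ (1 - θ) q a) (comb₂ (1 - θ) q b) ≤ θ * dist a b := by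
    simpa using dist_comb₂_le (t := 1 - θ) (by linarith) (by linarith) q a q b
  rw [ka, kb] at d3
  -- The contracted images of `a` and `b` are at distance at most `θ * dist a b`, while each lies
  -- within `β * dist a' b'` of its own endpoint.
  have d4 : dist a' b' ≤ β * dist a' b' + θ * dist a b + β * dist a' b' := by
    refine (dist_triangle4 _ (comb₂ (1 - β) a' b') (comb₂ (1 - β) b' a') _).trans ?_
    rw [dist_comm _ b']
    linarith
  have d5 : (1 - 2 * β) * dist a' b' ≤ θ * dist a b := by linarith
  have d6 : θ * (t * dist a' b') ≤ θ * (r * dist a b) := by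
    calc θ * (t * dist a' b') = r * ((1 - 2 * β) * dist a' b') := by rw [← mul_assoc, ← hβ2]; ring
      _ ≤ r * (θ * dist a b) := by gcongr
      _ = _ := by ring
  exact le_of_mul_le_mul_left d6 hθ0

/-- Homotheties between convex points scale all distances. -/
theorem dist_comb₂_left {t : ℝ} (h₀ : 0 < t) (h₁ : t < 1) {x y z : 𝔛}
    (hx : K x = x) (hy : K y = y) (hz : K z = z) :
    dist (comb₂ t x z) (comb₂ t y z) = t * dist x y := by
  apply le_antisymm
  · simpa using dist_comb₂_le h₀ h₁ x z y z
  -- For the lower bound, `r → 1` in `mul_dist_comb₂_le`: `comb₂ r x z` and `comb₂ r y z` approach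
  -- `x` and `y` at distance `O(1 - r)`.
  have hlim : Tendsto (fun r : ℝ => r * dist (comb₂ t x z) (comb₂ t y z) +
      t * (1 - r) * (dist x z + dist y z)) (𝓝[<] 1)
      (𝓝 (1 * dist (comb₂ t x z) (comb₂ t y z) + t * (1 - 1) * (dist x z + dist y z))) :=
    tendsto_nhdsWithin_of_tendsto_nhds (Continuous.tendsto (by fun_prop) 1)
  rw [sub_self, mul_zero, zero_mul, one_mul, add_zero] at hlim
  refine ge_of_tendsto hlim ?_
  filter_upwards [Ioo_mem_nhdsLT h₁] with r hr
  have hr0 := h₀.trans hr.1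
  have h := mul_dist_comb₂_le h₀ hr.1 hr.2 hx hy hz
  have d1 := dist_comb₂_self_le hr0 hr.2 x z hx
  have d2 := dist_comb₂_self_le hr0 hr.2 y z hy
  have d3 := dist_triangle4 x (comb₂ r x z) (comb₂ r y z) y
  rw [dist_comm y (comb₂ r y z)] at d2
  nlinarith

namespace WeightedPoint

/-- The distance of two weighted points of the same mass, after convexification. -/
noncomputable def kdist (a b : WeightedPoint 𝔛) : ℝ := a.mass * dist (K a.pt) (K b.pt)

theorem kdist_self (a : WeightedPoint 𝔛) : kdist a a = 0 := by simp [kdist]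

theorem kdist_comm {a b : WeightedPoint 𝔛} (h : a.mass = b.mass) : kdist a b = kdist b a := by
  rw [kdist, kdist, h, dist_comm]

theorem kdist_triangle {a b c : WeightedPoint 𝔛} (h : a.mass = b.mass) :
    kdist a c ≤ kdist a b + kdist b c := by
  rw [kdist, kdist, kdist, ← h, ← mul_add]
  exact mul_le_mul_of_nonneg_left (dist_triangle _ _ _) a.mass_nonneg

theorem kdist_wt {s : ℝ} (hs : 0 < s) (x y : 𝔛) :
    kdist (wt s x) (wt s y) = s * dist (K x) (K y) := by
  rw [kdist, wt_mass hs.le, wt_pt hs, wt_pt hs]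

/-- Adding mass `r` at `z` is a homothety of ratio `s / (s + r)`, which scales the distance by
exactly that factor; the new total mass `s + r` compensates. This is the metric form of cancellation
in the cone. -/
theorem kdist_add_right {a b : WeightedPoint 𝔛} (h : a.mass = b.mass) (c : WeightedPoint 𝔛) :
    kdist (a + c) (b + c) = kdist a b := by
  rcases eq_zero_or_wt a with rfl | ⟨s, x, hs, rfl⟩
  · have hb : b = 0 := by
      by_contra hb
      exact (mass_pos_of_ne_zero hb).ne h
    rw [hb, kdist_self, kdist_self]
  rcases eq_zero_or_wt c with rfl | ⟨r, z, hr, rfl⟩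
  · simp
  rcases eq_zero_or_wt b with rfl | ⟨t, y, ht, rfl⟩
  · simp [wt_mass hs.le, hs.ne'] at h
  rw [wt_mass hs.le, wt_mass ht.le] at h
  subst h
  have h1 : s / (s + r) < 1 := by rw [div_lt_one (by positivity)]; linarith
  rw [wt_add_wt hs hr, wt_add_wt hs hr, kdist_wt (by positivity), kdist_wt hs,
    K_comb₂ (by positivity) h1, K_comb₂ (by positivity) h1,
    dist_comb₂_left (by positivity) h1 (K_K _) (K_K _) (K_K _)]
  field_simp

theorem kdist_add_le {a b c d : WeightedPoint 𝔛} (h : a.mass = b.mass) (h' : c.mass = d.mass) :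
    kdist (a + c) (b + d) ≤ kdist a b + kdist c d := by
  have h1 : (a + c).mass = (b + c).mass := by rw [mass_add, mass_add, h]
  refine (kdist_triangle h1).trans ?_
  rw [kdist_add_right h, add_comm b c, add_comm b d, kdist_add_right h']

theorem kdist_scale {c : ℝ} (hc : 0 < c) (a b : WeightedPoint 𝔛) (h : a.mass = b.mass) :
    kdist (scale c hc a) (scale c hc b) = c * kdist a b := by
  rcases eq_zero_or_wt a with rfl | ⟨s, x, hs, rfl⟩
  · simp [kdist]
  rcases eq_zero_or_wt b with rfl | ⟨t, y, ht, rfl⟩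
  · simp [wt_mass hs.le, hs.ne'] at h
  rw [wt_mass hs.le, wt_mass ht.le] at h
  subst h
  rw [scale_wt hc hs.le, scale_wt hc hs.le, kdist_wt hs, kdist_wt (by positivity), mul_assoc]

end WeightedPoint

/-! ### The barycenter seminorm and the Banach space. -/

open scoped NNReal

/-- The weighted barycenter of the convexifications of a finite family of weighted points. -/
noncomputable def bary : (𝔛 →₀ ℝ≥0) →+ WeightedPoint 𝔛 :=
  Finsupp.liftAddHom fun x =>
    { toFun := fun r => wt (r : ℝ) (K x)
      map_zero' := by simp
      map_add' := fun r s => by rw [NNReal.coe_add, wt_add_K r.coe_nonneg s.coe_nonneg] }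

theorem bary_single (x : 𝔛) (r : ℝ≥0) : bary (Finsupp.single x r) = wt (r : ℝ) (K x) := by
  simp [bary]

theorem total_toReal (m : 𝔛 →₀ ℝ≥0) : total 𝔛 (toRealFinsupp m) = (bary m).mass := by
  have : (total 𝔛).toAddMonoidHom.comp toRealFinsupp = (massHom 𝔛).comp (bary (𝔛 := 𝔛)) := by
    refine Finsupp.addHom_ext fun x r => ?_
    change total 𝔛 (toRealFinsupp (Finsupp.single x r)) = (bary (Finsupp.single x r)).mass
    rw [bary_single, wt_mass r.coe_nonneg, toReal_single, total_single]
  exact DFunLike.congr_fun this m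

theorem mass_bary_eq {m : 𝔛 →₀ ℝ} (hm : total 𝔛 m = 0) :
    (bary (posFinsupp m)).mass = (bary (posFinsupp (-m))).mass := by
  rw [← total_toReal, ← total_toReal, ← sub_eq_zero, ← map_sub, toReal_pos_sub, hm]

/-- The transport-type norm of a finitely supported function of total mass zero. -/
noncomputable def baryNorm (m : 𝔛 →₀ ℝ) : ℝ :=
  kdist (bary (posFinsupp m)) (bary (posFinsupp (-m)))

/-- Any decomposition into parts of equal mass may replace the positive and negative parts, by
invariance of `kdist`. Subadditivity follows, since sums of positive parts need not be positive
parts of sums. -/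
theorem baryNorm_eq {m : 𝔛 →₀ ℝ} {μ ν : 𝔛 →₀ ℝ≥0} (h : m = toRealFinsupp μ - toRealFinsupp ν)
    (hμν : (bary μ).mass = (bary ν).mass) : baryNorm m = kdist (bary μ) (bary ν) := by
  have hm : total 𝔛 m = 0 := by rw [h, map_sub, total_toReal, total_toReal, hμν, sub_self]
  -- Two decompositions of the same `m` agree after cross-addition, which avoids subtraction in the
  -- cone.
  have e : μ + posFinsupp (-m) = posFinsupp m + ν := by
    apply toRealFinsupp_injective
    have := toReal_pos_sub m
    rw [map_add, map_add]
    nth_rewrite 3 [h] at this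
    rw [sub_eq_sub_iff_add_eq_add] at this
    exact this.symm
  rw [baryNorm, ← kdist_add_right (mass_bary_eq hm) (bary ν), ← map_add, ← e, map_add,
    add_comm (bary (posFinsupp (-m))), kdist_add_right hμν]

theorem baryNorm_add_le {m n : 𝔛 →₀ ℝ} (hm : total 𝔛 m = 0) (hn : total 𝔛 n = 0) :
    baryNorm (m + n) ≤ baryNorm m + baryNorm n := by
  have h := baryNorm_eq (m := m + n) (μ := posFinsupp m + posFinsupp n)
    (ν := posFinsupp (-m) + posFinsupp (-n))
    (by rw [map_add, map_add, add_sub_add_comm, toReal_pos_sub, toReal_pos_sub])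
    (by rw [map_add, map_add, mass_add, mass_add, mass_bary_eq hm, mass_bary_eq hn])
  rw [h, map_add, map_add]
  exact kdist_add_le (mass_bary_eq hm) (mass_bary_eq hn)

theorem baryNorm_neg {m : 𝔛 →₀ ℝ} (hm : total 𝔛 m = 0) : baryNorm (-m) = baryNorm m := by
  rw [baryNorm, baryNorm, neg_neg, kdist_comm (mass_bary_eq hm)]

theorem baryNorm_smul_of_pos {m : 𝔛 →₀ ℝ} (hm : total 𝔛 m = 0) {c : ℝ} (hc : 0 < c) :
    baryNorm (c • m) = c * baryNorm m := by
  have hb : ∀ m : 𝔛 →₀ ℝ, bary (posFinsupp (c • m)) = scale c hc (bary (posFinsupp m)) := by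
    intro m
    have e : posFinsupp (c • m) = c.toNNReal • posFinsupp m := by
      ext x
      simp [posFinsupp, Real.toNNReal_mul hc.le]
    have e2 : bary.comp (DistribSMul.toAddMonoidHom (𝔛 →₀ ℝ≥0) c.toNNReal) =
        (scale c hc).comp (bary (𝔛 := 𝔛)) := by
      refine Finsupp.addHom_ext fun x r => ?_
      simp only [AddMonoidHom.comp_apply, DistribSMul.toAddMonoidHom_apply, Finsupp.smul_single,
        bary_single, smul_eq_mul]
      rw [scale_wt hc r.coe_nonneg, NNReal.coe_mul, Real.coe_toNNReal _ hc.le]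
    rw [e]
    exact DFunLike.congr_fun e2 _
  rw [baryNorm, ← smul_neg, hb, hb, kdist_scale hc _ _ (mass_bary_eq hm), baryNorm]

theorem baryNorm_smul {m : 𝔛 →₀ ℝ} (hm : total 𝔛 m = 0) (c : ℝ) :
    baryNorm (c • m) = |c| * baryNorm m := by
  rcases lt_trichotomy c 0 with hc | rfl | hc
  · rw [← baryNorm_neg (by rw [map_smul, hm, smul_zero]), ← neg_smul,
      baryNorm_smul_of_pos hm (by linarith), abs_of_neg hc]
  · simp [baryNorm, kdist_self]
  · rw [baryNorm_smul_of_pos hm hc, abs_of_pos hc]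

variable (𝔛) in
/-- Subtracting a point mass so as to make the total mass zero. -/
noncomputable def balance : (𝔛 →₀ ℝ) →ₗ[ℝ] (𝔛 →₀ ℝ) :=
  LinearMap.id - (Finsupp.lsingle (comb 0 ![] ![])).comp (total 𝔛)

theorem balance_apply (m : 𝔛 →₀ ℝ) :
    balance 𝔛 m = m - Finsupp.single (comb 0 ![] ![]) (total 𝔛 m) := rfl

theorem total_balance (m : 𝔛 →₀ ℝ) : total 𝔛 (balance 𝔛 m) = 0 := by
  rw [balance_apply, map_sub, total_single, sub_self]

theorem balance_of_total {m : 𝔛 →₀ ℝ} (hm : total 𝔛 m = 0) : balance 𝔛 m = m := by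
  rw [balance_apply, hm, Finsupp.single_zero, sub_zero]

variable (𝔛) in
/-- The seminorm on finitely supported functions that measures distances of barycenters. -/
noncomputable def barySeminorm : Seminorm ℝ (𝔛 →₀ ℝ) :=
  Seminorm.of (fun m => baryNorm (balance 𝔛 m))
    (fun m n => by
      rw [map_add]
      exact baryNorm_add_le (total_balance m) (total_balance n))
    (fun c m => by rw [map_smul, baryNorm_smul (total_balance m), Real.norm_eq_abs])

theorem barySeminorm_sub (μ ν : 𝔛 →₀ ℝ≥0) (h : (bary μ).mass = (bary ν).mass) :
    barySeminorm 𝔛 (toRealFinsupp μ - toRealFinsupp ν) = kdist (bary μ) (bary ν) := by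
  change baryNorm (balance 𝔛 _) = _
  rw [balance_of_total (by rw [map_sub, total_toReal, total_toReal, h, sub_self]),
    baryNorm_eq rfl h]

theorem barySeminorm_single_sub (x y : 𝔛) :
    barySeminorm 𝔛 (Finsupp.single x 1 - Finsupp.single y 1) = dist (K x) (K y) := by
  have h := barySeminorm_sub (Finsupp.single x 1) (Finsupp.single y 1)
    (by rw [bary_single, bary_single, wt_mass (by simp), wt_mass (by simp)])
  rw [toReal_single, toReal_single, bary_single, bary_single, NNReal.coe_one, kdist_wt one_pos,
    K_K, K_K, one_mul] at h
  exact h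

/-- A combination and its weighted endpoints have the same barycenter, so they are identified in the
separated completion. This is what makes the embedding affine. -/
theorem barySeminorm_comb₂ {t : ℝ} (h₀ : 0 < t) (h₁ : t < 1) (x y : 𝔛) :
    barySeminorm 𝔛 (Finsupp.single (comb₂ t x y) 1 -
      (Finsupp.single x t + Finsupp.single y (1 - t))) = 0 := by
  have ht : 0 < 1 - t := by linarith
  have e : bary (Finsupp.single (comb₂ t x y) 1) =
      bary (Finsupp.single x t.toNNReal + Finsupp.single y (1 - t).toNNReal) := by
    rw [map_add, bary_single, bary_single, bary_single, K_comb₂ h₀ h₁, NNReal.coe_one,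
      wt_comb₂ one_pos h₀ h₁, one_mul, one_mul, Real.coe_toNNReal _ h₀.le,
      Real.coe_toNNReal _ ht.le]
  have h := barySeminorm_sub _ _ (congrArg mass e)
  rw [e, kdist_self, map_add, toReal_single, toReal_single, toReal_single,
    Real.coe_toNNReal _ h₀.le, Real.coe_toNNReal _ ht.le] at h
  exact h

/-- The convexification of a CC space embeds isometrically and affinely into a Banach space. -/
theorem exists_affine_embedding.{u} (𝔛 : Type u) [MetricSpace 𝔛] [CCSpace 𝔛] :
    ∃ (E : Type u) (_ : NormedAddCommGroup E) (_ : NormedSpace ℝ E) (_ : CompleteSpace E)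
      (ι : 𝔛 → E), (∀ x y, dist (ι x) (ι y) = dist (K x) (K y)) ∧
        ∀ t, 0 < t → t < 1 → ∀ x y, ι (comb₂ t x y) = t • ι x + (1 - t) • ι y := by
  let _ : SeminormedAddCommGroup (𝔛 →₀ ℝ) :=
    (barySeminorm 𝔛).toAddGroupSeminorm.toSeminormedAddCommGroup
  have hnorm : ∀ m : 𝔛 →₀ ℝ, ‖m‖ = barySeminorm 𝔛 m := fun _ => rfl
  let _ : NormedSpace ℝ (𝔛 →₀ ℝ) :=
    { norm_smul_le := fun c m => by rw [hnorm, hnorm, map_smul_eq_mul] }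
  refine ⟨UniformSpace.Completion (𝔛 →₀ ℝ), inferInstance, inferInstance, inferInstance,
    fun x => ((Finsupp.single x 1 : 𝔛 →₀ ℝ) : UniformSpace.Completion (𝔛 →₀ ℝ)),
    fun x y => ?_, fun t h₀ h₁ x y => ?_⟩
  · rw [UniformSpace.Completion.dist_eq, dist_eq_norm, hnorm, barySeminorm_single_sub]
  · rw [← UniformSpace.Completion.coe_smul, ← UniformSpace.Completion.coe_smul,
      ← UniformSpace.Completion.coe_add, ← dist_eq_zero, UniformSpace.Completion.dist_eq,
      dist_eq_norm, hnorm, Finsupp.smul_single, Finsupp.smul_single, smul_eq_mul, smul_eq_mul,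
      mul_one, mul_one, barySeminorm_comb₂ h₀ h₁]

end Embedding

/-! ### Combinations under an affine embedding. -/

section AffineEmbedding

variable {𝔛 : Type*} [MetricSpace 𝔛] [CCSpace 𝔛]
  {E : Type*} [NormedAddCommGroup E] [NormedSpace ℝ E]

open WeightedPoint

/-- A map to a normed space that is affine and, on convexified points, isometric. -/
structure IsAffineEmbedding (ι : 𝔛 → E) : Prop where
  dist_eq : ∀ x y, dist (ι x) (ι y) = dist (K x) (K y)
  map_comb₂ : ∀ t, 0 < t → t < 1 → ∀ x y, ι (comb₂ t x y) = t • ι x + (1 - t) • ι y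

namespace IsAffineEmbedding

variable {ι : 𝔛 → E}

theorem dist_le (hι : IsAffineEmbedding ι) (x y : 𝔛) : dist (ι x) (ι y) ≤ dist x y := hι.dist_eq x y ▸ dist_K_le x y

theorem continuous (hι : IsAffineEmbedding ι) : Continuous ι :=
  (LipschitzWith.of_dist_le_mul (K := 1) fun u v => by simpa using hι.dist_le u v).continuous

theorem map_K (hι : IsAffineEmbedding ι) (x : 𝔛) : ι (K x) = ι x := by
  rw [← dist_eq_zero, hι.dist_eq, K_K, dist_self]

theorem dist_eq_of_K (hι : IsAffineEmbedding ι) {x y : 𝔛} (hx : K x = x) (hy : K y = y) : dist (ι x) (ι y) = dist x y := by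
  rw [hι.dist_eq, hx, hy]

theorem eq_of_K (hι : IsAffineEmbedding ι) {x y : 𝔛} (hx : K x = x) (hy : K y = y) (h : ι x = ι y) : x = y := by
  rw [← dist_eq_zero, ← hι.dist_eq_of_K hx hy, h, dist_self]

theorem map_comb (hι : IsAffineEmbedding ι) {n : ℕ} (w : Fin n → ℝ) (u : Fin n → 𝔛) (hw : IsWeight w) :
    ι (comb n w u) = ∑ i, w i • ι (u i) := by
  let f : WeightedPoint 𝔛 →+ E := lift (fun s x => s • ι x) (by simp) fun s t x y hs ht => by
    have : s / (s + t) < 1 := by rw [div_lt_one (by positivity)]; linarith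
    rw [hι.map_comb₂ _ (by positivity) this, smul_add, smul_smul, smul_smul]
    congr 2 <;> (field_simp; try ring)
  have hf : ∀ s x, 0 ≤ s → f (wt s x) = s • ι x := fun s x hs => lift_wt _ _ _ hs x
  have h := congrArg f (wt_comb w u hw)
  rw [hf _ _ zero_le_one, one_smul, map_sum] at h
  rw [h]
  exact Finset.sum_congr rfl fun i _ => hf _ _ (hw.1 i).le

end IsAffineEmbedding

theorem isWeight_combOn {α : Type*} {s : Finset α} {w : α → ℝ} (h₀ : ∀ i ∈ s, 0 ≤ w i)
    (h₁ : ∑ i ∈ s, w i = 1) :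
    IsWeight fun k => w ((s.filter fun i => 0 < w i).equivFin.symm k) := by
  refine ⟨fun k => (Finset.mem_filter.1
    ((s.filter fun i => 0 < w i).equivFin.symm k).2).2, ?_⟩
  rw [Equiv.sum_comp (s.filter fun i => 0 < w i).equivFin.symm (fun j => w j),
    Finset.sum_coe_sort (s.filter fun i => 0 < w i) w, Finset.sum_filter_of_ne, h₁]
  exact fun i hi hne => lt_of_le_of_ne (h₀ i hi) (Ne.symm hne)

theorem K_combOn {α : Type*} {s : Finset α} {w : α → ℝ} (x : α → 𝔛) (h₀ : ∀ i ∈ s, 0 ≤ w i)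
    (h₁ : ∑ i ∈ s, w i = 1) :
    K (combOn s w fun i => K (x i)) = combOn s w fun i => K (x i) :=
  K_comb_K _ (fun k => x ((s.filter fun i => 0 < w i).equivFin.symm k)) (isWeight_combOn h₀ h₁)

theorem IsAffineEmbedding.map_combOn {ι : 𝔛 → E} (hι : IsAffineEmbedding ι) {α : Type*}
    {s : Finset α} {w : α → ℝ} (x : α → 𝔛) (h₀ : ∀ i ∈ s, 0 ≤ w i) (h₁ : ∑ i ∈ s, w i = 1) :
    ι (combOn s w x) = ∑ i ∈ s, w i • ι (x i) := by
  refine (hι.map_comb _ _ (isWeight_combOn h₀ h₁)).trans ?_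
  rw [Equiv.sum_comp (s.filter fun i => 0 < w i).equivFin.symm (fun j => w j • ι (x j)),
    Finset.sum_coe_sort (s.filter fun i => 0 < w i) fun i => w i • ι (x i),
    Finset.sum_filter_of_ne]
  exact fun i hi hne => lt_of_le_of_ne (h₀ i hi) fun h => hne (by rw [← h, zero_smul])

end AffineEmbedding

/-! ### Finitely valued random elements. -/

section SimpleCondExp

variable {Ω : Type*} {𝒢 : MeasurableSpace Ω} {mΩ : MeasurableSpace Ω} {P : Measure Ω}
  [IsProbabilityMeasure P]

/-- The conditional expectation of a function of a finitely valued random element. -/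
theorem condExp_comp_of_finite_range {α : Type*} {S : Ω → α} (hS : (Set.range S).Finite)
    (hm : ∀ x, NullMeasurableSet (S ⁻¹' {x}) P)
    {F : Type*} [NormedAddCommGroup F] [NormedSpace ℝ F] [CompleteSpace F] (c : α → F) :
    (P[fun ω => c (S ω) | 𝒢]) =ᵐ[P] fun ω => ∑ x ∈ hS.toFinset,
      (P[(S ⁻¹' {x}).indicator (fun _ => (1 : ℝ)) | 𝒢]) ω • c x := by
  have hint : ∀ x, Integrable ((S ⁻¹' {x}).indicator fun _ => (1 : ℝ)) P := fun x =>
    (integrable_const (1 : ℝ)).indicator₀ (hm x)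
  let T : α → ℝ →L[ℝ] F := fun x => ContinuousLinearMap.toSpanSingleton ℝ (c x)
  have hsum : (fun ω => c (S ω)) =
      ∑ x ∈ hS.toFinset, T x ∘ (S ⁻¹' {x}).indicator fun _ => (1 : ℝ) := by
    ext ω
    rw [Finset.sum_apply, Finset.sum_eq_single (S ω)]
    · simp [T]
    · intro x _ hx
      have : ω ∉ S ⁻¹' {x} := fun h => hx h.symm
      simp [T, this]
    · intro h
      exact absurd (hS.mem_toFinset.2 ⟨ω, rfl⟩) h
  rw [hsum]
  refine (condExp_finsetSum (fun x _ => (T x).integrable_comp (hint x)) 𝒢).trans ?_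
  have h := (Finset.eventually_all hS.toFinset).2 fun x _ =>
    (T x).comp_condExp_comm (m := 𝒢) (hint x)
  filter_upwards [h] with ω hω
  rw [Finset.sum_apply]
  refine Finset.sum_congr rfl fun x hx => ?_
  exact (hω x hx).symm

variable {𝔛 : Type*} [MetricSpace 𝔛] [CCSpace 𝔛]
  {E : Type*} [NormedAddCommGroup E] [NormedSpace ℝ E] [CompleteSpace E]

theorem IsAffineEmbedding.simpleCondExp_spec (h𝒢 : 𝒢 ≤ mΩ) {ι : 𝔛 → E}
    (hι : IsAffineEmbedding ι) {S : Ω → 𝔛} (hS : (Set.range S).Finite)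
    (hm : ∀ x, NullMeasurableSet (S ⁻¹' {x}) P) :
    ∀ᵐ ω ∂P, K (simpleCondExp 𝒢 P S hS ω) = simpleCondExp 𝒢 P S hS ω ∧
      ι (simpleCondExp 𝒢 P S hS ω) = (P[fun ω => ι (S ω) | 𝒢]) ω := by
  have h0 := (Finset.eventually_all hS.toFinset).2 fun x _ =>
    condExp_nonneg (m := 𝒢) (μ := P) (f := (S ⁻¹' {x}).indicator fun _ => (1 : ℝ))
      (Eventually.of_forall fun ω => Set.indicator_nonneg (fun _ _ => zero_le_one) ω)
  -- With the constant function `1`, the expansion says that the conditional probabilities of the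
  -- values sum to one almost surely.
  have h1 := condExp_comp_of_finite_range (𝒢 := 𝒢) hS hm fun _ => (1 : ℝ)
  rw [condExp_const h𝒢] at h1
  filter_upwards [h0, h1, condExp_comp_of_finite_range (𝒢 := 𝒢) hS hm ι] with ω h0 h1 h2
  have h1' : ∑ x ∈ hS.toFinset, (P[(S ⁻¹' {x}).indicator (fun _ => (1 : ℝ)) | 𝒢]) ω = 1 := by
    simpa using h1.symm
  refine ⟨K_combOn id h0 h1', ?_⟩
  rw [h2, simpleCondExp, hι.map_combOn _ h0 h1']
  exact Finset.sum_congr rfl fun x _ => by rw [hι.map_K]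

/-- The expectation is the conditional expectation given the trivial σ-algebra, so its properties
need no separate proof. -/
theorem simpleCondExp_bot {S : Ω → 𝔛} (hS : (Set.range S).Finite)
    (hm : ∀ x, NullMeasurableSet (S ⁻¹' {x}) P) (ω : Ω) :
    simpleCondExp ⊥ P S hS ω = simpleExp P S hS := by
  have : (fun x => (P[(S ⁻¹' {x}).indicator (fun _ => (1 : ℝ)) | ⊥]) ω) =
      fun x => P.real (S ⁻¹' {x}) := by
    ext x
    rw [condExp_bot, integral_indicator₀ (hm x)]
    simp
  rw [simpleCondExp, this, simpleExp]

end SimpleCondExp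

/-! ### Passage to the limit, measurability and representation. -/

section CondExpectation

variable {Ω : Type*} {𝒢 : MeasurableSpace Ω} {mΩ : MeasurableSpace Ω} {P : Measure Ω}

/-- The conditional expectations are almost surely decreasing and nonnegative, and their integrals
tend to zero, which forces the pointwise limit to be zero. -/
theorem tendsto_condExp_of_antitone (h𝒢 : 𝒢 ≤ mΩ) [IsFiniteMeasure P] {g : ℕ → Ω → ℝ}
    (hint : ∀ n, Integrable (g n) P) (hnn : ∀ n ω, 0 ≤ g n ω) (hanti : ∀ ω, Antitone fun n => g n ω)
    (hlim : ∀ ω, Tendsto (fun n => g n ω) atTop (𝓝 0)) :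
    ∀ᵐ ω ∂P, Tendsto (fun n => (P[g n | 𝒢]) ω) atTop (𝓝 0) := by
  refine tendsto_of_integral_tendsto_of_antitone (F := fun _ => 0) (fun n => integrable_condExp)
    (integrable_zero _ _ _) ?_ ?_ ?_
  · simp_rw [integral_condExp h𝒢]
    refine tendsto_integral_of_dominated_convergence (g 0) (fun n => (hint n).1) (hint 0)
      (fun n => Eventually.of_forall fun ω => ?_) (Eventually.of_forall hlim)
    rw [Real.norm_of_nonneg (hnn n ω)]
    exact hanti ω (Nat.zero_le n)
  · have : ∀ᵐ ω ∂P, ∀ n, (P[g (n + 1) | 𝒢]) ω ≤ (P[g n | 𝒢]) ω := ae_all_iff.2 fun n =>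
      condExp_mono (hint _) (hint _) (Eventually.of_forall fun ω => hanti ω n.le_succ)
    exact this.mono fun ω h => antitone_nat_of_succ_le h
  · exact ae_all_iff.2 fun n => condExp_nonneg (Eventually.of_forall (hnn n))

theorem tendsto_condExp_of_norm_sub_le (h𝒢 : 𝒢 ≤ mΩ) [IsFiniteMeasure P]
    {E : Type*} [NormedAddCommGroup E] [NormedSpace ℝ E] [CompleteSpace E]
    {f : ℕ → Ω → E} {f₀ : Ω → E} {g : ℕ → Ω → ℝ} (hf : ∀ n, Integrable (f n) P)
    (hf₀ : Integrable f₀ P) (hfg : ∀ n ω, ‖f n ω - f₀ ω‖ ≤ g n ω)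
    (hint : ∀ n, Integrable (g n) P) (hanti : ∀ ω, Antitone fun n => g n ω)
    (hlim : ∀ ω, Tendsto (fun n => g n ω) atTop (𝓝 0)) :
    ∀ᵐ ω ∂P, Tendsto (fun n => (P[f n | 𝒢]) ω) atTop (𝓝 ((P[f₀ | 𝒢]) ω)) := by
  have h1 : ∀ᵐ ω ∂P, ∀ n, ‖(P[f n | 𝒢]) ω - (P[f₀ | 𝒢]) ω‖ ≤ (P[g n | 𝒢]) ω := by
    refine ae_all_iff.2 fun n => ?_
    filter_upwards [condExp_sub (hf n) hf₀ 𝒢, norm_condExp_le (m := 𝒢) (μ := P) (f n - f₀),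
      condExp_mono (m := 𝒢) ((hf n).sub hf₀).norm (hint n) (Eventually.of_forall (hfg n))]
      with ω a b c
    rw [a] at b
    exact b.trans c
  filter_upwards [h1, tendsto_condExp_of_antitone h𝒢 hint
    (fun n ω => (norm_nonneg _).trans (hfg n ω)) hanti hlim] with ω a b
  rw [tendsto_iff_norm_sub_tendsto_zero]
  exact squeeze_zero (fun _ => norm_nonneg _) a b

variable {𝔛 : Type*} [MetricSpace 𝔛]

section Approx

variable [MeasurableSpace 𝔛] [OpensMeasurableSpace 𝔛]

theorem dist_psi_le (u : ℕ → 𝔛) (x : 𝔛) {k n : ℕ} (hk : k ≤ n) :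
    dist (psi u n x) x ≤ dist (u k) x := by
  have h := SimpleFunc.edist_nearestPt_le u x hk
  rw [edist_dist, edist_dist] at h
  exact (ENNReal.ofReal_le_ofReal_iff dist_nonneg).1 h

/-- The point chosen at stage `m` still competes at every later stage. -/
theorem antitone_dist_psi (u : ℕ → 𝔛) (x : 𝔛) : Antitone fun n => dist (psi u n x) x :=
  fun m _ h => dist_psi_le u x ((SimpleFunc.nearestPtInd_le u m x).trans h)

theorem tendsto_psi {u : ℕ → 𝔛} (hu : DenseRange u) (x : 𝔛) :
    Tendsto (fun n => psi u n x) atTop (𝓝 x) :=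
  SimpleFunc.tendsto_nearestPt (hu x)

theorem nullMeasurableSet_psi_comp (u : ℕ → 𝔛) (n : ℕ) {X : Ω → 𝔛} (hX : AEMeasurable X P)
    (x : 𝔛) : NullMeasurableSet ((fun ω => psi u n (X ω)) ⁻¹' {x}) P :=
  ((SimpleFunc.nearestPt u n).measurable.comp_aemeasurable hX).nullMeasurable
    (measurableSet_singleton x)

end Approx

theorem MemL1.integrable_dist {X : Ω → 𝔛} (h𝒢 : 𝒢 ≤ mΩ) [IsFiniteMeasure P] (hX : MemL1 𝒢 P X)
    (b : 𝔛) : Integrable (fun ω => dist b (X ω)) P := by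
  obtain ⟨hm, a, ha⟩ := hX
  refine ((integrable_const (dist b a)).add ha).mono'
    ((continuous_const.dist continuous_id).comp_aestronglyMeasurable (hm.mono h𝒢))
    (Eventually.of_forall fun ω => ?_)
  rw [Real.norm_of_nonneg dist_nonneg]
  exact dist_triangle _ _ _

theorem MemL1.mono {X : Ω → 𝔛} (h𝒢 : 𝒢 ≤ mΩ) (hX : MemL1 𝒢 P X) : MemL1 mΩ P X :=
  ⟨hX.1.mono h𝒢, hX.2⟩

variable [CCSpace 𝔛]

variable {E : Type*} [NormedAddCommGroup E] [NormedSpace ℝ E] {ι : 𝔛 → E}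

theorem IsAffineEmbedding.integrable_comp (hι : IsAffineEmbedding ι) [IsFiniteMeasure P]
    {X : Ω → 𝔛} (hX : MemL1 mΩ P X) : Integrable (fun ω => ι (X ω)) P := by
  obtain ⟨hm, a, ha⟩ := hX
  refine ((integrable_const ‖ι a‖).add ha).mono' (hι.continuous.comp_aestronglyMeasurable hm)
    (Eventually.of_forall fun ω => ?_)
  have h := hι.dist_le a (X ω)
  rw [dist_eq_norm] at h
  have := norm_sub_norm_le (ι (X ω)) (ι a)
  rw [norm_sub_rev] at this
  simp only [Pi.add_apply]
  linarith

/-- Convergence of the images makes the convex points `c n` a Cauchy sequence by isometry;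
completeness and closedness of the range of `K` keep the limit convex. -/
theorem IsAffineEmbedding.exists_tendsto [CompleteSpace 𝔛] (hι : IsAffineEmbedding ι) {c : ℕ → 𝔛}
    (hc : ∀ n, K (c n) = c n) {e : E} (h : Tendsto (fun n => ι (c n)) atTop (𝓝 e)) :
    ∃ z, Tendsto c atTop (𝓝 z) ∧ K z = z ∧ ι z = e := by
  have hcs := cauchySeq_iff_tendsto_dist_atTop_0.1 h.cauchySeq
  simp_rw [fun i j => hι.dist_eq_of_K (hc i) (hc j)] at hcs
  obtain ⟨z, hz⟩ := cauchySeq_tendsto_of_complete (cauchySeq_iff_tendsto_dist_atTop_0.2 hcs)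
  refine ⟨z, hz, ?_, tendsto_nhds_unique ((hι.continuous.tendsto z).comp hz) h⟩
  exact mem_range_K_iff.1 (isClosed_range_K.mem_of_tendsto hz
    (Eventually.of_forall fun n => mem_range_K_iff.2 (hc n)))

/-- On convex points `ι` is a closed embedding, so measurability of the image pulls back through its
inverse. Off the preimage of the closed range, a set in `𝒢`, an arbitrary convex point is used. -/
theorem IsAffineEmbedding.aestronglyMeasurable_of_comp [CompleteSpace 𝔛] (hι : IsAffineEmbedding ι) {Z : Ω → 𝔛}
    {h : Ω → E} (hh : StronglyMeasurable[𝒢] h) (hZ : ∀ᵐ ω ∂P, K (Z ω) = Z ω ∧ ι (Z ω) = h ω) :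
    AEStronglyMeasurable[𝒢] Z P := by
  classical
  have : CompleteSpace (Set.range (K : 𝔛 → 𝔛)) := isClosed_range_K.completeSpace_coe
  let φ : Set.range (K : 𝔛 → 𝔛) → E := fun x => ι x
  have hφi : Isometry φ := Isometry.of_dist_eq fun x y =>
    hι.dist_eq_of_K (mem_range_K_iff.1 x.2) (mem_range_K_iff.1 y.2)
  have hφ := hφi.isClosedEmbedding
  let x₀ : Set.range (K : 𝔛 → 𝔛) := ⟨K (comb 0 ![] ![]), _, rfl⟩
  have : Nonempty (Set.range (K : 𝔛 → 𝔛)) := ⟨x₀⟩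
  borelize E
  have hA : MeasurableSet[𝒢] (h ⁻¹' Set.range φ) := hh.measurable hφ.isClosed_range.measurableSet
  let Z' : Ω → Set.range (K : 𝔛 → 𝔛) := (h ⁻¹' Set.range φ).piecewise
    (fun ω => Function.invFun φ (h ω)) fun _ => x₀
  have hZ' : StronglyMeasurable[𝒢] fun ω => φ (Z' ω) := by
    have : (fun ω => φ (Z' ω)) = (h ⁻¹' Set.range φ).piecewise h fun _ => φ x₀ := by
      ext ω
      by_cases hω : ω ∈ h ⁻¹' Set.range φ
      · simp only [Z', Set.piecewise_eq_of_mem _ _ _ hω]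
        exact Function.invFun_eq hω
      · simp only [Z', Set.piecewise_eq_of_notMem _ _ _ hω]
    rw [this]
    exact hh.piecewise hA stronglyMeasurable_const
  have hZ'' := (Embedding.comp_stronglyMeasurable_iff hφ.isEmbedding).1 hZ'
  refine ⟨fun ω => Z' ω, continuous_subtype_val.comp_stronglyMeasurable hZ'', ?_⟩
  filter_upwards [hZ] with ω hω
  have hmem : ω ∈ h ⁻¹' Set.range φ := ⟨⟨Z ω, mem_range_K_iff.2 hω.1⟩, hω.2⟩
  have : φ (Z' ω) = h ω := by
    simp only [Z', Set.piecewise_eq_of_mem _ _ _ hmem]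
    exact Function.invFun_eq hmem
  exact hι.eq_of_K hω.1 (mem_range_K_iff.1 (Z' ω).2) (hω.2.trans this.symm)

variable [MeasurableSpace 𝔛] [BorelSpace 𝔛]

theorem condExpectation_bot [IsProbabilityMeasure P] (u : ℕ → 𝔛) {X : Ω → 𝔛}
    (hX : AEMeasurable X P) (ω : Ω) : condExpectation u ⊥ P X ω = expectation u P X := by
  have : (fun n => condExpSeq u ⊥ P X n ω) = fun n => expSeq u P X n := funext fun n =>
    simpleCondExp_bot _ (nullMeasurableSet_psi_comp u n hX) ω
  rw [condExpectation, expectation, this]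

/-- Continuity in the weight and the distance axiom give joint continuity of `(t, x, y) ↦ comb₂ t x
y` for `0 < t < 1`, hence measurability with random weights. -/
theorem MemL1.comb₂ [TopologicalSpace.SeparableSpace 𝔛] {ξ : Ω → ℝ} (hξ : AEStronglyMeasurable ξ P)
    (hξ₁ : ∀ᵐ ω ∂P, 0 < ξ ω ∧ ξ ω < 1) [IsFiniteMeasure P] {X Y : Ω → 𝔛}
    (hX : MemL1 mΩ P X) (hY : MemL1 mΩ P Y) :
    MemL1 mΩ P fun ω => comb₂ (ξ ω) (X ω) (Y ω) := by
  classical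
  have : SecondCountableTopology 𝔛 := UniformSpace.secondCountable_of_separable 𝔛
  let s : Set (ℝ × 𝔛 × 𝔛) := {p | p.1 ∈ Set.Ioo 0 1}
  let Φ : ℝ × 𝔛 × 𝔛 → 𝔛 := fun p => CCSpace.comb₂ p.1 p.2.1 p.2.2
  have hs : MeasurableSet s := measurable_fst measurableSet_Ioo
  have hΦ : ContinuousOn Φ s := by
    rintro ⟨t₀, x₀, y₀⟩ h₀
    rw [ContinuousWithinAt, tendsto_iff_dist_tendsto_zero]
    have hc : ContinuousAt (fun t : ℝ => CCSpace.comb₂ t x₀ y₀) t₀ :=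
      (comb_continuousOn x₀ y₀).continuousAt (Ioo_mem_nhds h₀.1 h₀.2)
    have hc' : ContinuousAt (fun p : ℝ × 𝔛 × 𝔛 => CCSpace.comb₂ p.1 x₀ y₀) (t₀, x₀, y₀) :=
      ContinuousAt.comp (f := Prod.fst) (x := (t₀, x₀, y₀)) hc continuousAt_fst
    have h1 : ContinuousAt (fun p : ℝ × 𝔛 × 𝔛 => dist p.2.1 x₀ + dist p.2.2 y₀ +
        dist (CCSpace.comb₂ p.1 x₀ y₀) (CCSpace.comb₂ t₀ x₀ y₀)) (t₀, x₀, y₀) := by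
      refine ContinuousAt.add (by fun_prop) (hc'.dist continuousAt_const)
    have h2 := h1.tendsto
    simp only [dist_self, add_zero] at h2
    refine squeeze_zero' (Eventually.of_forall fun _ => dist_nonneg) ?_
      (tendsto_nhdsWithin_of_tendsto_nhds h2)
    filter_upwards [self_mem_nhdsWithin] with p hp
    refine (dist_triangle _ (CCSpace.comb₂ p.1 x₀ y₀) _).trans ?_
    gcongr
    refine (dist_comb₂_le hp.1 hp.2 _ _ _ _).trans ?_
    have hp1 := hp.1
    have hp2 := hp.2
    nlinarith [dist_nonneg (x := p.2.1) (y := x₀), dist_nonneg (x := p.2.2) (y := y₀)]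
  have hm : Measurable (s.piecewise Φ fun p => p.2.1) :=
    hΦ.measurable_piecewise (by fun_prop) hs
  have hae : AEMeasurable (fun ω => CCSpace.comb₂ (ξ ω) (X ω) (Y ω)) P := by
    refine (hm.comp_aemeasurable (hξ.aemeasurable.prodMk
      (hX.1.aemeasurable.prodMk hY.1.aemeasurable))).congr ?_
    filter_upwards [hξ₁] with ω hω
    exact Set.piecewise_eq_of_mem s Φ (fun p => p.2.1) (i := (ξ ω, X ω, Y ω)) hω
  -- A convex base point satisfies `comb₂ t a a = a` for every weight, so the distance axiom bounds
  -- the distance from `a` directly.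
  let a : 𝔛 := K (comb 0 ![] ![])
  refine ⟨hae.aestronglyMeasurable, a, ?_⟩
  refine ((hX.integrable_dist le_rfl a).add (hY.integrable_dist le_rfl a)).mono'
    (aemeasurable_const.dist hae).aestronglyMeasurable ?_
  filter_upwards [hξ₁] with ω ⟨h₀, h₁⟩
  rw [Real.norm_of_nonneg dist_nonneg]
  have h := dist_comb₂_le h₀ h₁ a a (X ω) (Y ω)
  rw [comb₂_K_self h₀ h₁] at h
  simp only [Pi.add_apply]
  nlinarith [dist_nonneg (x := a) (y := X ω), dist_nonneg (x := a) (y := Y ω)]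

variable [CompleteSpace 𝔛] [TopologicalSpace.SeparableSpace 𝔛] [CompleteSpace E]

/-- The conditional expectation is the point of `K(𝔛)` that represents the Bochner conditional
expectation. -/
theorem IsAffineEmbedding.condExpectation_spec [IsProbabilityMeasure P]
    (hι : IsAffineEmbedding ι) (h𝒢 : 𝒢 ≤ mΩ) {u : ℕ → 𝔛} (hu : DenseRange u) {X : Ω → 𝔛}
    (hX : MemL1 mΩ P X) :
    ∀ᵐ ω ∂P, Tendsto (fun n => condExpSeq u 𝒢 P X n ω) atTop (𝓝 (condExpectation u 𝒢 P X ω)) ∧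
      K (condExpectation u 𝒢 P X ω) = condExpectation u 𝒢 P X ω ∧
      ι (condExpectation u 𝒢 P X ω) = (P[fun ω => ι (X ω) | 𝒢]) ω := by
  have : SecondCountableTopology 𝔛 := UniformSpace.secondCountable_of_separable 𝔛
  have hXm : AEMeasurable X P := hX.1.aemeasurable
  have hd : ∀ n, Integrable (fun ω => dist (psi u n (X ω)) (X ω)) P := fun n => by
    refine (hX.integrable_dist le_rfl (u 0)).mono' ?_ (Eventually.of_forall fun ω => ?_)
    · exact (((SimpleFunc.nearestPt u n).measurable.comp_aemeasurable hXm).dist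
        hXm).aestronglyMeasurable
    · rw [Real.norm_of_nonneg dist_nonneg]
      exact dist_psi_le u _ (Nat.zero_le n)
  have hpsi : ∀ n, MemL1 mΩ P fun ω => psi u n (X ω) := fun n => by
    refine ⟨((SimpleFunc.nearestPt u n).measurable.comp_aemeasurable hXm).aestronglyMeasurable,
      u 0, ?_⟩
    refine ((hX.integrable_dist le_rfl (u 0)).add (hd n)).mono' ?_
      (Eventually.of_forall fun ω => ?_)
    · exact ((measurable_const (a := u 0)).aemeasurable.dist
        ((SimpleFunc.nearestPt u n).measurable.comp_aemeasurable hXm)).aestronglyMeasurable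
    · rw [Real.norm_of_nonneg dist_nonneg]
      exact dist_triangle_right _ _ _
  -- The discretisation error `dist (psi u n (X ω)) (X ω)` decreases to zero and dominates the error
  -- after applying `ι`.
  have hlim := tendsto_condExp_of_norm_sub_le h𝒢 (fun n => hι.integrable_comp (hpsi n))
    (hι.integrable_comp hX)
    (fun n ω => by rw [← dist_eq_norm]; exact hι.dist_le (psi u n (X ω)) (X ω)) hd
    (fun ω => antitone_dist_psi u (X ω))
    (fun ω => tendsto_iff_dist_tendsto_zero.1 (tendsto_psi hu (X ω)))
  have hspec := ae_all_iff.2 fun n => hι.simpleCondExp_spec (P := P) h𝒢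
    (finite_range_psi_comp u n X) (nullMeasurableSet_psi_comp u n hXm)
  filter_upwards [hlim, hspec] with ω h1 h2
  obtain ⟨z, hz, hKz, hιz⟩ := hι.exists_tendsto (c := fun n => condExpSeq u 𝒢 P X n ω)
    (fun n => (h2 n).1) (h1.congr fun n => (h2 n).2.symm)
  have : condExpectation u 𝒢 P X ω = z := hz.limUnder_eq
  rw [this]
  exact ⟨hz, hKz, hιz⟩

theorem IsAffineEmbedding.memL1_condExpectation [IsProbabilityMeasure P]
    (hι : IsAffineEmbedding ι) (h𝒢 : 𝒢 ≤ mΩ) {u : ℕ → 𝔛} (hu : DenseRange u) {X : Ω → 𝔛}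
    (hX : MemL1 mΩ P X) : MemL1 𝒢 P (condExpectation u 𝒢 P X) := by
  have hs := hι.condExpectation_spec h𝒢 hu hX
  refine ⟨hι.aestronglyMeasurable_of_comp (stronglyMeasurable_condExp (μ := P)
    (f := fun ω => ι (X ω))) (hs.mono fun ω h => h.2), K (u 0), ?_⟩
  have hint : Integrable (fun ω => ‖ι (K (u 0)) - (P[fun ω => ι (X ω) | 𝒢]) ω‖) P :=
    ((integrable_const _).sub integrable_condExp).norm
  refine hint.congr ?_
  filter_upwards [hs] with ω h
  rw [← h.2.2, ← dist_eq_norm, hι.dist_eq_of_K (K_K _) h.2.1]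

theorem IsAffineEmbedding.expectation_spec [IsProbabilityMeasure P]
    (hι : IsAffineEmbedding ι) {u : ℕ → 𝔛} (hu : DenseRange u) {X : Ω → 𝔛} (hX : MemL1 mΩ P X) :
    Tendsto (expSeq u P X) atTop (𝓝 (expectation u P X)) ∧
      K (expectation u P X) = expectation u P X ∧
      ι (expectation u P X) = ∫ ω, ι (X ω) ∂P := by
  -- For the trivial σ-algebra nothing depends on `ω`, so one point of the almost sure set suffices.
  obtain ⟨ω, h⟩ := (hι.condExpectation_spec (𝒢 := ⊥) bot_le hu hX).exists
  have hXm : AEMeasurable X P := hX.1.aemeasurable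
  have e : (fun n => condExpSeq u ⊥ P X n ω) = expSeq u P X := funext fun n =>
    simpleCondExp_bot _ (nullMeasurableSet_psi_comp u n hXm) ω
  rw [condExpectation_bot u hXm, condExp_bot, e] at h
  exact h

end CondExpectation

end CCSpace

/-! ### Transfer of the Bochner properties. -/

theorem CCSpace.indep_comap_congr {𝔛 Ω : Type*} [m𝔛 : MeasurableSpace 𝔛] {𝒢 : MeasurableSpace Ω}
    {mΩ : MeasurableSpace Ω} {P : Measure Ω} {X X' : Ω → 𝔛} (h : X =ᵐ[P] X')
    (hi : Indep (MeasurableSpace.comap X m𝔛) 𝒢 P) :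
    Indep (MeasurableSpace.comap X' m𝔛) 𝒢 P := by
  rw [Indep_iff] at hi ⊢
  rintro _ t ⟨A, hA, rfl⟩ ht
  have e : X ⁻¹' A =ᵐ[P] X' ⁻¹' A := by
    filter_upwards [h] with ω hω
    exact congrArg A hω
  rw [← measure_congr e, ← measure_congr (e.inter (ae_eq_refl t))]
  exact hi _ _ ⟨A, hA, rfl⟩ ht

theorem proposition4p10
    {𝔛 : Type*} [MetricSpace 𝔛] [CompleteSpace 𝔛] [TopologicalSpace.SeparableSpace 𝔛]
    [CCSpace 𝔛] [MeasurableSpace 𝔛] [BorelSpace 𝔛]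
    -- the reference point `u 0 ∈ K(𝔛)` and the dense sequence `u 1, u 2, …`
    (u : ℕ → 𝔛) (hu₀ : u 0 ∈ Set.range (CCSpace.K : 𝔛 → 𝔛))
    (hu : DenseRange (fun j : ℕ => u (j + 1)))
    {Ω : Type*} (𝒢 𝒢₁ 𝒢₂ : MeasurableSpace Ω) {ℱ : MeasurableSpace Ω}
    (P : Measure Ω) [IsProbabilityMeasure P]
    (h𝒢 : 𝒢 ≤ ℱ) (h𝒢₁₂ : 𝒢₁ ≤ 𝒢₂) (h𝒢₂ : 𝒢₂ ≤ ℱ)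
    (X Y : Ω → 𝔛) (hX : CCSpace.MemL1 ℱ P X) (hY : CCSpace.MemL1 ℱ P Y) :
    -- `E X` and `E(X | 𝒢)` are well defined, and `E(X | 𝒢)` belongs to `L¹_{K(𝔛)}(𝒢)`
    (Tendsto (CCSpace.expSeq u P X) atTop (𝓝 (CCSpace.expectation u P X)) ∧
      (∀ᵐ ω ∂P, Tendsto (fun n => CCSpace.condExpSeq u 𝒢 P X n ω) atTop
        (𝓝 (CCSpace.condExpectation u 𝒢 P X ω))) ∧
      CCSpace.MemL1 𝒢 P (CCSpace.condExpectation u 𝒢 P X) ∧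
      ∀ᵐ ω ∂P, CCSpace.condExpectation u 𝒢 P X ω ∈ Set.range (CCSpace.K : 𝔛 → 𝔛)) ∧
    -- 1) `E(E(X | 𝒢)) = E X`
    CCSpace.expectation u P (CCSpace.condExpectation u 𝒢 P X) = CCSpace.expectation u P X ∧
    -- 2) `E(X | 𝒢) = E X` if `σ(X)` and `𝒢` are independent
    (Indep (MeasurableSpace.comap X inferInstance) 𝒢 P →
      ∀ᵐ ω ∂P, CCSpace.condExpectation u 𝒢 P X ω = CCSpace.expectation u P X) ∧
    -- 3) `E(X | 𝒢) = K X` if `X` is `𝒢`-measurable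
    (AEStronglyMeasurable[𝒢] X P →
      ∀ᵐ ω ∂P, CCSpace.condExpectation u 𝒢 P X ω = CCSpace.K (X ω)) ∧
    -- 4) random weights that are `𝒢`-measurable, and constant weights
    (∀ ξ : Ω → ℝ, AEStronglyMeasurable[𝒢] ξ P → (∀ᵐ ω ∂P, 0 < ξ ω ∧ ξ ω < 1) →
      CCSpace.MemL1 ℱ P (fun ω => CCSpace.comb₂ (ξ ω) (X ω) (Y ω)) ∧
      ∀ᵐ ω ∂P,
        CCSpace.condExpectation u 𝒢 P (fun ω' => CCSpace.comb₂ (ξ ω') (X ω') (Y ω')) ω =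
          CCSpace.comb₂ (ξ ω) (CCSpace.condExpectation u 𝒢 P X ω)
            (CCSpace.condExpectation u 𝒢 P Y ω)) ∧
    (∀ t : ℝ, 0 < t → t < 1 →
      ∀ᵐ ω ∂P,
        CCSpace.condExpectation u 𝒢 P (fun ω' => CCSpace.comb₂ t (X ω') (Y ω')) ω =
          CCSpace.comb₂ t (CCSpace.condExpectation u 𝒢 P X ω)
            (CCSpace.condExpectation u 𝒢 P Y ω)) ∧
    -- 5) the tower property for `𝒢₁ ⊆ 𝒢₂`
    (∀ᵐ ω ∂P,
      CCSpace.condExpectation u 𝒢₂ P (CCSpace.condExpectation u 𝒢₁ P X) ω =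
          CCSpace.condExpectation u 𝒢₁ P X ω ∧
        CCSpace.condExpectation u 𝒢₁ P (CCSpace.condExpectation u 𝒢₂ P X) ω =
          CCSpace.condExpectation u 𝒢₁ P X ω) := by
  have hu' : DenseRange u := hu.mono (by rintro _ ⟨j, rfl⟩; exact ⟨j + 1, rfl⟩)
  have : SecondCountableTopology 𝔛 := UniformSpace.secondCountable_of_separable 𝔛
  obtain ⟨E, _, _, _, ι, hdist, hcomb⟩ := CCSpace.exists_affine_embedding 𝔛
  have hι : CCSpace.IsAffineEmbedding ι := ⟨hdist, hcomb⟩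
  have spec := fun {𝒢 : MeasurableSpace Ω} (h : 𝒢 ≤ ℱ) {X : Ω → 𝔛} (hX : CCSpace.MemL1 ℱ P X) =>
    hι.condExpectation_spec h hu' hX
  have mem := fun {𝒢 : MeasurableSpace Ω} (h : 𝒢 ≤ ℱ) {X : Ω → 𝔛} (hX : CCSpace.MemL1 ℱ P X) =>
    hι.memL1_condExpectation h hu' hX
  have memℱ := fun {𝒢 : MeasurableSpace Ω} (h : 𝒢 ≤ ℱ) {X : Ω → 𝔛} (hX : CCSpace.MemL1 ℱ P X) =>
    (mem h hX).mono h
  have espec := fun {X : Ω → 𝔛} (hX : CCSpace.MemL1 ℱ P X) => hι.expectation_spec hu' hX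
  have repr := fun {𝒢 : MeasurableSpace Ω} (h : 𝒢 ≤ ℱ) {X : Ω → 𝔛} (hX : CCSpace.MemL1 ℱ P X) =>
    (show (fun ω => ι (CCSpace.condExpectation u 𝒢 P X ω)) =ᵐ[P] P[fun ω => ι (X ω) | 𝒢] from
      (spec h hX).mono fun _ h => h.2.2)
  have main4 : ∀ ξ : Ω → ℝ, AEStronglyMeasurable[𝒢] ξ P → (∀ᵐ ω ∂P, 0 < ξ ω ∧ ξ ω < 1) →
      CCSpace.MemL1 ℱ P (fun ω => CCSpace.comb₂ (ξ ω) (X ω) (Y ω)) ∧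
      ∀ᵐ ω ∂P,
        CCSpace.condExpectation u 𝒢 P (fun ω' => CCSpace.comb₂ (ξ ω') (X ω') (Y ω')) ω =
          CCSpace.comb₂ (ξ ω) (CCSpace.condExpectation u 𝒢 P X ω)
            (CCSpace.condExpectation u 𝒢 P Y ω) := by
    intro ξ hξ hξ₁
    have hL := CCSpace.MemL1.comb₂ (hξ.mono h𝒢) hξ₁ hX hY
    refine ⟨hL, ?_⟩
    have hXi := hι.integrable_comp hX
    have hYi := hι.integrable_comp hY
    have hη : AEStronglyMeasurable[𝒢] (fun ω => 1 - ξ ω) P :=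
      aestronglyMeasurable_const.sub hξ
    have hi1 : Integrable (ξ • fun ω => ι (X ω)) P := by
      refine hXi.bdd_smul 1 (hξ.mono h𝒢) (hξ₁.mono fun ω h => ?_)
      rw [Real.norm_eq_abs, abs_le]
      constructor <;> linarith
    have hi2 : Integrable ((fun ω => 1 - ξ ω) • fun ω => ι (Y ω)) P := by
      refine hYi.bdd_smul 1 (hη.mono h𝒢) (hξ₁.mono fun ω h => ?_)
      rw [Real.norm_eq_abs, abs_le]
      constructor <;> linarith
    -- Affinity of `ι` turns the random combination into a sum of products, from which the
    -- `𝒢`-measurable bounded factors can be pulled out.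
    have hc : (fun ω => ι (CCSpace.comb₂ (ξ ω) (X ω) (Y ω))) =ᵐ[P]
        (ξ • fun ω => ι (X ω)) + (fun ω => 1 - ξ ω) • fun ω => ι (Y ω) :=
      hξ₁.mono fun ω h => hcomb _ h.1 h.2 _ _
    filter_upwards [hξ₁, spec h𝒢 hL, spec h𝒢 hX, spec h𝒢 hY, condExp_congr_ae (m := 𝒢) hc,
      condExp_add hi1 hi2 𝒢, condExp_smul_of_aestronglyMeasurable_left hξ hi1 hXi,
      condExp_smul_of_aestronglyMeasurable_left hη hi2 hYi]
      with ω hω ⟨_, k1, e1⟩ ⟨_, k2, e2⟩ ⟨_, k3, e3⟩ a1 a2 a3 a4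
    refine hι.eq_of_K k1 ?_ ?_
    · rw [CCSpace.K_comb₂ hω.1 hω.2, k2, k3]
    · rw [e1, a1, a2, Pi.add_apply, a3, a4, hcomb _ hω.1 hω.2, e2, e3]
      rfl
  refine ⟨⟨(espec hX).1, (spec h𝒢 hX).mono fun _ h => h.1, mem h𝒢 hX,
    (spec h𝒢 hX).mono fun _ h => CCSpace.mem_range_K_iff.2 h.2.1⟩, ?_, ?_, ?_, main4, ?_, ?_⟩
  · refine hι.eq_of_K (espec (memℱ h𝒢 hX)).2.1 (espec hX).2.1 ?_
    rw [(espec (memℱ h𝒢 hX)).2.2, (espec hX).2.2, integral_congr_ae (repr h𝒢 hX),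
      integral_condExp h𝒢]
  · intro hi
    -- `X` is measurable only up to a null set, so `σ(X)` need not lie in `ℱ`. Independence is first
    -- moved to a measurable version.
    obtain ⟨X', hX'm, hXX'⟩ := hX.1
    have hi' := CCSpace.indep_comap_congr hXX' hi
    have hsm : StronglyMeasurable[MeasurableSpace.comap X' inferInstance] fun ω => ι (X' ω) :=
      hι.continuous.comp_stronglyMeasurable (comap_measurable X').stronglyMeasurable
    have h1 := condExp_indep_eq hX'm.measurable.comap_le h𝒢 hsm hi'
    have hae : (fun ω => ι (X ω)) =ᵐ[P] fun ω => ι (X' ω) := hXX'.fun_comp ι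
    filter_upwards [spec h𝒢 hX, condExp_congr_ae (m := 𝒢) hae, h1] with ω ⟨_, k, e⟩ a b
    refine hι.eq_of_K k (espec hX).2.1 ?_
    rw [e, a, b, (espec hX).2.2, integral_congr_ae hae]
  · intro hXG
    filter_upwards [spec h𝒢 hX, condExp_of_aestronglyMeasurable' h𝒢
      (hι.continuous.comp_aestronglyMeasurable hXG) (hι.integrable_comp hX)] with ω ⟨_, k, e⟩ a
    exact hι.eq_of_K k (CCSpace.K_K _) (by rw [e, a, hι.map_K])
  · exact fun t h₀ h₁ =>
      (main4 (fun _ => t) aestronglyMeasurable_const (Eventually.of_forall fun _ => ⟨h₀, h₁⟩)).2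
  · have h𝒢₁ := h𝒢₁₂.trans h𝒢₂
    have hself : P[P[fun ω => ι (X ω) | 𝒢₁] | 𝒢₂] = P[fun ω => ι (X ω) | 𝒢₁] :=
      condExp_of_stronglyMeasurable h𝒢₂ (stronglyMeasurable_condExp.mono h𝒢₁₂) integrable_condExp
    filter_upwards [spec h𝒢₂ (memℱ h𝒢₁ hX), spec h𝒢₁ (memℱ h𝒢₂ hX), spec h𝒢₁ hX,
      condExp_congr_ae (m := 𝒢₂) (repr h𝒢₁ hX), condExp_congr_ae (m := 𝒢₁) (repr h𝒢₂ hX),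
      condExp_condExp_of_le (μ := P) (f := fun ω => ι (X ω)) h𝒢₁₂ h𝒢₂]
      with ω ⟨_, k1, e1⟩ ⟨_, k2, e2⟩ ⟨_, k3, e3⟩ a b c
    exact ⟨hι.eq_of_K k1 k3 (by rw [e1, a, hself, e3]),
      hι.eq_of_K k2 k3 (by rw [e2, b, c, e3])⟩
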